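/- Let $M$ be a smooth $d$-dimensional (Hausdorff) manifold with a smooth Riemannian metric and Riemannian measure $dy$, and let $\rho\colon V\to U$ be the inverse of a smooth chart of $M$, with $V=\rho^{-1}(U)\subseteq\mathbb R^d$ and $U\subseteq M$ open. Let $\mu\colon V\to\mathbb R$ and $W\colon V\to\mathbb R^{d\times d}$ be smooth, with $\mu>0$ and $W$ symmetric positive definite almost everywhere on $V$. Set $$g:=\mu W^{-1},\qquad \nu:=\mu/\sqrt{\det g},$$ and assume that the metric of $M$ in the coordinates $\rho$ is $g$, i.e. $\langle d\rho_x e_i,d\rho_x e_j\rangle=g_{ij}(x)$ for all $x\in V$; $\nu$ is regarded as a function on $U$ through $\rho$. Identify complex 1-forms with complex vector fields on $M$ by means of the metric. Let $L^2(U,\nu)\oplus L^2(TU,\nu I)$ be the space of pairs $v=(v_1,v_2)$ of a measurable function $v_1\colon U\to\mathbb C$ and a measurable complex 1-form $v_2$ on $U$, modulo equality almost everywhere, with $$\|v\|^2=\int_U|v_1|^2\,\nu\,dy+\int_U|v_2|^2\,\nu\,dy<\infty,$$ and let $L^2(V,\mu)\oplus L^2(V;\mathbb C^d,W)$ be the space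 of pairs $u=(u_1,u_2)$ of measurable functions $u_1\colon V\to\mathbb C$, $u_2\colon V\to\mathbb C^d$, modulo equality almost everywhere, with $$\|u\|^2=\int_V|u_1|^2\,\mu\,dx+\int_V\langle Wu_2,u_2\rangle\,dx<\infty .$$ Let $$T(v_1,v_2)(x)=\bigl(v_1(\rho(x)),\ (d\rho_x)^{*}v_2(\rho(x))\bigr),\qquad x\in V,$$ where $(d\rho_x)^*$ is the pullback of 1-forms. Let $$D=\begin{bmatrix}0&-\frac1\mu\,\mathrm{div}\,W\\ \nabla&0\end{bmatrix},\qquad D_M=\begin{bmatrix}0&-\frac1\nu\,\mathrm{div}_M\,\nu\\ \nabla_M&0\end{bmatrix}$$ on $V$ and on $U$ respectively, where the derivatives are taken in the sense of distributions and the domains are maximal. Then $T$ is a well-defined, surjective linear isometry from $L^2(U,\nu)\oplus L^2(TU,\nu I)$ onto $L^2(V,\mu)\oplus L^2(V;\mathbb C^d,W)$; a pair $v$ lies in the first space if and only if $Tv$ lies in the second. Moreover $T^{-1}DT=D_M$, with equality of domains: $v\in\mathrm{dom}(D_M)$ and $D_Mv=f$ if and only if $Tv\in\mathrm{dom}(D)$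 and $DTv=Tf$. The same equivalence holds with the spaces $L^2$ replaced by the corresponding spaces $L^2_{\mathrm{loc}}$. -/

import Mathlib

open Set MeasureTheory Manifold Bundle
open scoped ContDiff ComplexConjugate

noncomputable section

namespace RubberBand

/-! ### Flat objects: weights, `L²`-spaces and the operator `D` on an open set of `ℝᵈ` -/

/-- The Euclidean space `ℝᵈ`. -/
abbrev Euc (d : ℕ) : Type := EuclideanSpace ℝ (Fin d)

/-- The `i`-th standard unit vector of `ℝᵈ`. -/
abbrev stdVec {d : ℕ} (i : Fin d) : Euc d := EuclideanSpace.single i (1 : ℝ)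

/-- A scalar weight on `Ω`: positive almost everywhere on `Ω`. -/
def IsScalarWeight {d : ℕ} (Ω : Set (Euc d)) (μ : Euc d → ℝ) : Prop :=
  ∀ᵐ x ∂(volume.restrict Ω), 0 < μ x

/-- A matrix weight on `Ω`: symmetric and positive definite almost everywhere on `Ω`. -/
def IsMatrixWeight {d : ℕ} (Ω : Set (Euc d)) (W : Euc d → Matrix (Fin d) (Fin d) ℝ) : Prop :=
  ∀ᵐ x ∂(volume.restrict Ω), (W x).PosDef

/-- The metric matrix `g = μ W⁻¹`. -/
def metricMatrix {d : ℕ} (μ : Euc d → ℝ) (W : Euc d → Matrix (Fin d) (Fin d) ℝ) (x : Euc d) :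
    Matrix (Fin d) (Fin d) ℝ :=
  μ x • (W x)⁻¹

/-- Pairs of a complex function and a complex vector field on `ℝᵈ`. -/
abbrev FlatPair (d : ℕ) : Type := (Euc d → ℂ) × (Euc d → Fin d → ℂ)

/-- `(W ξ)_i = ∑ j, W i j ξ j` for a real matrix `W` and a complex vector `ξ`. -/
def applyW {d : ℕ} (W : Matrix (Fin d) (Fin d) ℝ) (ξ : Fin d → ℂ) (i : Fin d) : ℂ :=
  ∑ j, (W i j : ℂ) * ξ j

/-- The squared norm `∫_Ω |u₁|² μ dx + ∫_Ω ⟨W u₂, u₂⟩ dx` of `L²(Ω, μ) ⊕ L²(Ω; ℂᵈ, W)`. -/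
def normSqFlat {d : ℕ} (Ω : Set (Euc d)) (μ : Euc d → ℝ)
    (W : Euc d → Matrix (Fin d) (Fin d) ℝ) (u : FlatPair d) : ENNReal :=
  (∫⁻ x in Ω, ENNReal.ofReal (‖u.1 x‖ ^ 2 * μ x)) +
    ∫⁻ x in Ω, ENNReal.ofReal (∑ i, applyW (W x) (u.2 x) i * conj (u.2 x i)).re

/-- Measurability on `Ω`, up to null sets. -/
def MeasurableFlat {d : ℕ} (Ω : Set (Euc d)) (u : FlatPair d) : Prop :=
  AEStronglyMeasurable u.1 (volume.restrict Ω) ∧ AEStronglyMeasurable u.2 (volume.restrict Ω)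

/-- `u` represents an element of `L²(Ω, μ) ⊕ L²(Ω; ℂᵈ, W)`. -/
def MemL2Flat {d : ℕ} (Ω : Set (Euc d)) (μ : Euc d → ℝ)
    (W : Euc d → Matrix (Fin d) (Fin d) ℝ) (u : FlatPair d) : Prop :=
  MeasurableFlat Ω u ∧ normSqFlat Ω μ W u < ⊤

/-- `u` represents an element of `L²_loc(Ω, μ) ⊕ L²_loc(Ω; ℂᵈ, W)`. -/
def MemL2LocFlat {d : ℕ} (Ω : Set (Euc d)) (μ : Euc d → ℝ)
    (W : Euc d → Matrix (Fin d) (Fin d) ℝ) (u : FlatPair d) : Prop :=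
  MeasurableFlat Ω u ∧ ∀ K ⊆ Ω, IsCompact K → normSqFlat K μ W u < ⊤

/-- Equality almost everywhere on `Ω`. -/
def AEEqFlat {d : ℕ} (Ω : Set (Euc d)) (u u' : FlatPair d) : Prop :=
  ∀ᵐ x ∂(volume.restrict Ω), u.1 x = u'.1 x ∧ u.2 x = u'.2 x

/-- Real test functions `C_c^∞(Ω)`. -/
def IsTestFlat {d : ℕ} (Ω : Set (Euc d)) (η : Euc d → ℝ) : Prop :=
  ContDiff ℝ ∞ η ∧ HasCompactSupport η ∧ tsupport η ⊆ Ω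

/-- The partial derivative `∂_i η`. -/
def pderiv {d : ℕ} (i : Fin d) (η : Euc d → ℝ) (x : Euc d) : ℝ := fderiv ℝ η x (stdVec i)

/-- `∇ u = G` in the sense of distributions on `Ω`, for locally integrable `u` and `G`. -/
def HasWeakGradFlat {d : ℕ} (Ω : Set (Euc d)) (u : Euc d → ℂ) (G : Euc d → Fin d → ℂ) : Prop :=
  ∀ η, IsTestFlat Ω η → ∀ i, ∫ x in Ω, u x * (pderiv i η x : ℂ) = -∫ x in Ω, G x i * (η x : ℂ)

/-- `div F = h` in the sense of distributions on `Ω`, for locally integrable `F` and `h`. -/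
def HasWeakDivFlat {d : ℕ} (Ω : Set (Euc d)) (F : Euc d → Fin d → ℂ) (h : Euc d → ℂ) : Prop :=
  ∀ η, IsTestFlat Ω η →
    ∫ x in Ω, ∑ i, F x i * (pderiv i η x : ℂ) = -∫ x in Ω, h x * (η x : ℂ)

/-- `D u = f` in the sense of distributions on `Ω`, where `D = [[0, -(1/μ) div W], [∇, 0]]`.
The first row `f₁ = -(1/μ) div (W u₂)` is written as `div (W u₂) = -μ f₁`. -/
def IsWeakD {d : ℕ} (Ω : Set (Euc d)) (μ : Euc d → ℝ)
    (W : Euc d → Matrix (Fin d) (Fin d) ℝ) (u f : FlatPair d) : Prop :=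
  HasWeakDivFlat Ω (fun x => applyW (W x) (u.2 x)) (fun x => -((μ x : ℂ) * f.1 x)) ∧
    HasWeakGradFlat Ω u.1 f.2

/-- The graph of `D` as an (unbounded) operator in `L²(Ω, μ) ⊕ L²(Ω; ℂᵈ, W)`, with derivatives
in the sense of distributions and with maximal domain. -/
def GraphD {d : ℕ} (Ω : Set (Euc d)) (μ : Euc d → ℝ)
    (W : Euc d → Matrix (Fin d) (Fin d) ℝ) (u f : FlatPair d) : Prop :=
  MemL2Flat Ω μ W u ∧ MemL2Flat Ω μ W f ∧ IsWeakD Ω μ W u f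

/-- The same operator on the local spaces `L²_loc`. -/
def GraphDLoc {d : ℕ} (Ω : Set (Euc d)) (μ : Euc d → ℝ)
    (W : Euc d → Matrix (Fin d) (Fin d) ℝ) (u f : FlatPair d) : Prop :=
  MemL2LocFlat Ω μ W u ∧ MemL2LocFlat Ω μ W f ∧ IsWeakD Ω μ W u f

/-! ### Objects on a Riemannian manifold -/

section Manifold

variable {d : ℕ} {M : Type*} [TopologicalSpace M] [ChartedSpace (Euc d) M]

/-- The `i`-th coordinate vector `dρ_x e_i` of a parametrisation `ρ : ℝᵈ → M`. -/
def coordVec (ρ : Euc d → M) (x : Euc d) (i : Fin d) : TangentSpace (𝓡 d) (ρ x) :=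
  mfderiv (𝓡 d) (𝓡 d) ρ x (stdVec i)

variable (d M) in
/-- Complex-valued 1-forms on `M` (arbitrary sections of the complexified cotangent bundle,
which the metric identifies with the complexified tangent bundle). -/
abbrev CForm : Type _ := (y : M) → (TangentSpace (𝓡 d) y →L[ℝ] ℂ)

variable (d M) in
/-- Pairs of a complex function and a complex 1-form on `M`. -/
abbrev ManifoldPair : Type _ := (M → ℂ) × CForm d M

/-- The pullback `(v₁, v₂) ↦ (v₁ ∘ ρ, dρ^* (v₂ ∘ ρ))`: composition for functions, and pullback for
1-forms, where the 1-form `dρ_x^* v₂(ρ x)` on `ℝᵈ` is given by its coefficients. -/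
def Tiso (ρ : Euc d → M) : ManifoldPair d M →ₗ[ℂ] FlatPair d where
  toFun v := (fun x => v.1 (ρ x), fun x i => v.2 (ρ x) (coordVec ρ x i))
  map_add' _ _ := rfl
  map_smul' _ _ := rfl

/-- Real test functions `C_c^∞(U)`. -/
def IsTest (U : Set M) (φ : M → ℝ) : Prop :=
  ContMDiff (𝓡 d) 𝓘(ℝ, ℝ) ∞ φ ∧ HasCompactSupport φ ∧ tsupport φ ⊆ U

variable [IsManifold (𝓡 d) ∞ M]

/-- Smooth real vector fields with compact support in `U`. -/
def IsTestField (U : Set M) (X : (y : M) → TangentSpace (𝓡 d) y) : Prop :=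
  ContMDiff (𝓡 d) (𝓡 d).tangent ∞ (fun y => (⟨y, X y⟩ : TangentBundle (𝓡 d) M)) ∧
    ∃ K ⊆ U, IsCompact K ∧ ∀ y ∉ K, X y = 0

variable [RiemannianBundle (fun y : M => TangentSpace (𝓡 d) y)]

/-- The matrix `⟨dρ e_i, dρ e_j⟩` of the Riemannian metric of `M` in the parametrisation `ρ`. -/
def gramMatrix (ρ : Euc d → M) (x : Euc d) : Matrix (Fin d) (Fin d) ℝ :=
  Matrix.of fun i j => inner ℝ (coordVec ρ x i) (coordVec ρ x j)

/-- The Riemannian norm `|α|² = ∑ |α(b_k)|²` (`b` an orthonormal basis of `T_y M`) of a complex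
covector; equivalently, the Hermitian norm of the complex tangent vector identified with it. -/
def covNormSq {y : M} (α : TangentSpace (𝓡 d) y →L[ℝ] ℂ) : ℝ :=
  haveI : FiniteDimensional ℝ (TangentSpace (𝓡 d) y) :=
    inferInstanceAs (FiniteDimensional ℝ (Euc d))
  ∑ k, ‖α (stdOrthonormalBasis ℝ (TangentSpace (𝓡 d) y) k)‖ ^ 2

/-- The Riemannian gradient of a real function: `⟨grad φ, X⟩ = dφ(X)`. -/
def riemGrad (φ : M → ℝ) (y : M) : TangentSpace (𝓡 d) y :=
  haveI : FiniteDimensional ℝ (TangentSpace (𝓡 d) y) :=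
    inferInstanceAs (FiniteDimensional ℝ (Euc d))
  haveI : CompleteSpace (TangentSpace (𝓡 d) y) := FiniteDimensional.complete ℝ _
  (InnerProductSpace.toDual ℝ (TangentSpace (𝓡 d) y)).symm
    (mfderiv (𝓡 d) 𝓘(ℝ, ℝ) φ y : TangentSpace (𝓡 d) y →L[ℝ] ℝ)

/-- The 1-form `⟨X, ·⟩` identified by the metric with the vector field `X`. -/
def flatForm (X : (y : M) → TangentSpace (𝓡 d) y) : CForm d M :=
  fun y => Complex.ofRealCLM ∘L (innerSL ℝ (X y))

variable [MeasurableSpace M]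

/-- The measure `√(det g) dx` of a coordinate patch, transported to `M`; here `ρ` is the inverse of
a chart. -/
def chartVolume (ρ : OpenPartialHomeomorph (Euc d) M) : Measure M :=
  Measure.map ρ ((volume.restrict ρ.source).withDensity
    fun x => ENNReal.ofReal (Real.sqrt (gramMatrix ρ x).det))

variable (d M) in
/-- The Riemannian measure `dy` of `M`. It is given by `√(det g) dx` in every chart of the maximal
smooth atlas: since these measures agree on overlaps, it is their supremum. -/
def riemVolume : Measure M :=
  ⨆ φ ∈ IsManifold.maximalAtlas (𝓡 d) ∞ M, chartVolume φ.symm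

/-- A 1-form is measurable on `U`, up to null sets, when its pairing with every vector field that
is smooth on `U` is. -/
def MeasurableForm (U : Set M) (α : CForm d M) : Prop :=
  ∀ X : (y : M) → TangentSpace (𝓡 d) y,
    ContMDiffOn (𝓡 d) (𝓡 d).tangent ∞ (fun y => (⟨y, X y⟩ : TangentBundle (𝓡 d) M)) U →
      AEStronglyMeasurable (fun y => α y (X y)) ((riemVolume d M).restrict U)

/-- Measurability on `U`, up to null sets. -/
def MeasurablePair (U : Set M) (v : ManifoldPair d M) : Prop :=
  AEStronglyMeasurable v.1 ((riemVolume d M).restrict U) ∧ MeasurableForm U v.2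

/-- The squared norm `∫_U |v₁|² ν dy + ∫_U |v₂|² ν dy` of `L²(U, ν) ⊕ L²(TU, ν I)`. -/
def normSqM (U : Set M) (ν : M → ℝ) (v : ManifoldPair d M) : ENNReal :=
  (∫⁻ y in U, ENNReal.ofReal (‖v.1 y‖ ^ 2 * ν y) ∂(riemVolume d M)) +
    ∫⁻ y in U, ENNReal.ofReal (covNormSq (v.2 y) * ν y) ∂(riemVolume d M)

/-- `v` represents an element of `L²(U, ν) ⊕ L²(TU, ν I)`. -/
def MemL2M (U : Set M) (ν : M → ℝ) (v : ManifoldPair d M) : Prop :=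
  MeasurablePair U v ∧ normSqM U ν v < ⊤

/-- `v` represents an element of `L²_loc(U, ν) ⊕ L²_loc(TU, ν I)`. -/
def MemL2LocM (U : Set M) (ν : M → ℝ) (v : ManifoldPair d M) : Prop :=
  MeasurablePair U v ∧ ∀ K ⊆ U, IsCompact K → normSqM K ν v < ⊤

/-- Equality almost everywhere on `U`. -/
def AEEqM (U : Set M) (v v' : ManifoldPair d M) : Prop :=
  ∀ᵐ y ∂((riemVolume d M).restrict U), v.1 y = v'.1 y ∧ v.2 y = v'.2 y

/-- `div_M α = h` in the sense of distributions on `U`, for locally integrable `α` and `h`, where `α`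
is identified with a vector field: `∫ ⟨α, dφ⟩ dy = -∫ h φ dy` for all test functions `φ`. -/
def HasWeakDivM (U : Set M) (α : CForm d M) (h : M → ℂ) : Prop :=
  ∀ φ : M → ℝ, IsTest (d := d) U φ →
    ∫ y in U, α y (riemGrad φ y) ∂(riemVolume d M) =
      -∫ y in U, h y * (φ y : ℂ) ∂(riemVolume d M)

/-- `∇_M v = α` in the sense of distributions on `U`: `∫ v div_M X dy = -∫ α(X) dy` for all smooth
vector fields `X` with compact support in `U`, for locally integrable `v` and `α`. Here `h = div_M X` is again a test function. -/
def HasWeakGradM (U : Set M) (v : M → ℂ) (α : CForm d M) : Prop :=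
  ∀ (X : (y : M) → TangentSpace (𝓡 d) y) (h : M → ℝ),
    IsTestField U X → IsTest (d := d) U h → HasWeakDivM U (flatForm X) (fun y => (h y : ℂ)) →
      ∫ y in U, v y * (h y : ℂ) ∂(riemVolume d M) = -∫ y in U, α y (X y) ∂(riemVolume d M)

/-- `D_M v = f` in the sense of distributions on `U`, where
`D_M = [[0, -(1/ν) div_M ν], [∇_M, 0]]`. The first row `f₁ = -(1/ν) div_M (ν v₂)` is written as
`div_M (ν v₂) = -ν f₁`. -/
def IsWeakDM (U : Set M) (ν : M → ℝ) (v f : ManifoldPair d M) : Prop :=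
  HasWeakDivM U (fun y => ν y • v.2 y) (fun y => -((ν y : ℂ) * f.1 y)) ∧ HasWeakGradM U v.1 f.2

/-- The graph of `D_M` as an (unbounded) operator in `L²(U, ν) ⊕ L²(TU, ν I)`, with derivatives in
the sense of distributions and with maximal domain. -/
def GraphDM (U : Set M) (ν : M → ℝ) (v f : ManifoldPair d M) : Prop :=
  MemL2M U ν v ∧ MemL2M U ν f ∧ IsWeakDM U ν v f

/-- The same operator on the local spaces `L²_loc`. -/
def GraphDMLoc (U : Set M) (ν : M → ℝ) (v f : ManifoldPair d M) : Prop :=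
  MemL2LocM U ν v ∧ MemL2LocM U ν f ∧ IsWeakDM U ν v f

end Manifold

end RubberBand

end

/-!
In the coordinates `ρ` every object on `M` becomes an explicit object on the parameter domain, and
the relations `W = μ g⁻¹` and `√g ν = μ` turn the weighted manifold objects into the flat ones.

*Measure.* The measures `√(det g) dx` of two charts agree on the overlap, by the change of variables
formula (`chartVolume_le_of_subset`), so in the domain of `ρ` their supremum is `√(det g) dx` itself
(`riemVolume_restrict_target`). The resulting integral formulas `setLIntegral_chart` and
`integral_target` hold for arbitrary functions, so that no integrability enters where the
definitions ask for none.

*Norms.* A covector `α` has `|α|² = ∑ gⁱʲ αᵢ ᾱⱼ` (`covNormSq_eq`), hence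
`√g ν |α|² = ⟨W ξ, ξ⟩` for its coefficients `ξ`. Since a 1-form is measurable exactly when its
coefficients are, this gives the isometry and the characterisation of the `L²` and `L²_loc` spaces.

*Divergence.* Test functions on the two sides correspond to each other, and the pairing of `α` with
`grad φ` is `∑ gⁱʲ αⱼ ∂ᵢφ`. Hence `div α = h` on `M` means `∂ᵢ(√g gⁱʲ αⱼ) = √g h`
(`hasWeakDivM_iff`); for `ν v₂` this is the equation for `div (W u₂)`.

*Gradient.* It is defined on `M` by testing with vector fields `X` and their divergences. Testing
with `X = (η / √g) ∂ᵢ` gives the `i`-th partial derivative (`HasWeakGradM.flat`). Conversely, the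
functions `√g Xⁱ` are test functions and `√g div X = ∑ᵢ ∂ᵢ(√g Xⁱ)`, so the identities of the partial
derivatives add up (`HasWeakGradFlat.manifold`). This sum needs local integrability, which follows
from membership in `L²_loc`, as `μ` and `g` are continuous and nondegenerate everywhere: `μ > 0`
holds at every point of the domain (`weight_pos`), not only almost everywhere.
-/

noncomputable section

namespace RubberBand

/-! ### Gram matrices and covectors -/

section LinearAlgebra

variable {d : ℕ} {F : Type*} [NormedAddCommGroup F] [InnerProductSpace ℝ F]

/-- The Gram matrix `⟨bᵢ, bⱼ⟩` of a basis. -/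
def gramOf (b : Module.Basis (Fin d) ℝ F) : Matrix (Fin d) (Fin d) ℝ :=
  Matrix.of fun i j => inner ℝ (b i) (b j)

theorem gramOf_posDef (b : Module.Basis (Fin d) ℝ F) : (gramOf b).PosDef :=
  (Matrix.posDef_gram_iff_linearIndependent (𝕜 := ℝ)).2 b.linearIndependent

theorem gramOf_isSymm (b : Module.Basis (Fin d) ℝ F) : (gramOf b).IsSymm := by
  ext i j; simp [gramOf, real_inner_comm]

/-- The basis dual to `b` with respect to the inner product, `bⁱ = ∑ⱼ gⁱʲ bⱼ`. -/
def dualVec (b : Module.Basis (Fin d) ℝ F) (i : Fin d) : F :=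
  ∑ j, (gramOf b)⁻¹ i j • b j

theorem inner_dualVec_basis (b : Module.Basis (Fin d) ℝ F) (i k : Fin d) :
    inner ℝ (dualVec b i) (b k) = if i = k then (1 : ℝ) else 0 := by
  have h : ((gramOf b)⁻¹ * gramOf b) i k = (1 : Matrix (Fin d) (Fin d) ℝ) i k := by
    rw [Matrix.nonsing_inv_mul _ (gramOf_posDef b).det_pos.ne'.isUnit]
  rw [Matrix.one_apply, Matrix.mul_apply] at h
  rw [← h, dualVec, sum_inner]
  simp [gramOf, real_inner_smul_left]

theorem inner_dualVec (b : Module.Basis (Fin d) ℝ F) (i : Fin d) (x : F) :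
    inner ℝ (dualVec b i) x = b.repr x i := by
  conv_lhs => rw [← b.sum_repr x]
  simp [inner_sum, real_inner_smul_right, inner_dualVec_basis, -Module.Basis.sum_repr]

theorem inner_dualVec_dualVec (b : Module.Basis (Fin d) ℝ F) (i j : Fin d) :
    inner ℝ (dualVec b i) (dualVec b j) = (gramOf b)⁻¹ i j := by
  rw [real_inner_comm, inner_dualVec, dualVec]
  simp [Finsupp.single_apply]

/-- The norm of a complex covector, in the coordinates of an arbitrary basis. -/
theorem sum_norm_sq_orthonormalBasis {ι : Type*} [Fintype ι] (o : OrthonormalBasis ι ℝ F)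
    (b : Module.Basis (Fin d) ℝ F) (α : F →L[ℝ] ℂ) :
    ((∑ k, ‖α (o k)‖ ^ 2 : ℝ) : ℂ) =
      ∑ i, applyW (gramOf b)⁻¹ (fun j => α (b j)) i * conj (α (b i)) := by
  -- expand `o k` in the basis `b`, then sum over `k` by Parseval for the dual vectors
  have key : ∀ k, α (o k) = ∑ i, (inner ℝ (dualVec b i) (o k) : ℂ) * α (b i) := by
    intro k
    conv_lhs => rw [← b.sum_repr (o k)]
    simp [inner_dualVec, -Module.Basis.sum_repr]
  have hs : ∀ i j, ∑ k, inner ℝ (dualVec b i) (o k) * inner ℝ (dualVec b j) (o k)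
      = (gramOf b)⁻¹ i j := by
    intro i j
    rw [← inner_dualVec_dualVec, ← o.sum_inner_mul_inner]
    simp [real_inner_comm]
  have h1 : ∀ k, ((‖α (o k)‖ ^ 2 : ℝ) : ℂ) = ∑ i, ∑ j,
      ((inner ℝ (dualVec b i) (o k) * inner ℝ (dualVec b j) (o k) : ℝ) : ℂ) *
        (α (b j) * conj (α (b i))) := by
    intro k
    rw [Complex.ofReal_pow, ← Complex.mul_conj', key k, map_sum, Finset.sum_mul_sum,
      Finset.sum_comm]
    refine Finset.sum_congr rfl fun i _ => Finset.sum_congr rfl fun j _ => ?_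
    simp only [map_mul, Complex.conj_ofReal, Complex.ofReal_mul]
    ring
  rw [Complex.ofReal_sum]
  simp_rw [h1, applyW, Finset.sum_mul]
  rw [Finset.sum_comm]
  refine Finset.sum_congr rfl fun i _ => ?_
  rw [Finset.sum_comm]
  refine Finset.sum_congr rfl fun j _ => ?_
  rw [← Finset.sum_mul, ← Complex.ofReal_sum, hs, mul_assoc]

/-- Each coefficient of a complex covector is controlled by its norm. -/
theorem norm_sq_apply_le {ι : Type*} [Fintype ι] (o : OrthonormalBasis ι ℝ F)
    (b : Module.Basis (Fin d) ℝ F) (α : F →L[ℝ] ℂ) (i : Fin d) :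
    ‖α (b i)‖ ^ 2 ≤ gramOf b i i * ∑ k, ‖α (o k)‖ ^ 2 := by
  have h1 : ‖α (b i)‖ ≤ ∑ k, |inner ℝ (o k) (b i)| * ‖α (o k)‖ := by
    conv_lhs => rw [← o.sum_repr' (b i), map_sum]
    refine (norm_sum_le _ _).trans_eq (Finset.sum_congr rfl fun k _ => ?_)
    rw [map_smul, norm_smul, Real.norm_eq_abs]
  have h2 : gramOf b i i = ∑ k, |inner ℝ (o k) (b i)| ^ 2 := by
    rw [gramOf, Matrix.of_apply, ← o.sum_inner_mul_inner]
    exact Finset.sum_congr rfl fun k _ => by rw [sq_abs, real_inner_comm, sq]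
  rw [h2]
  exact (pow_le_pow_left₀ (norm_nonneg _) h1 2).trans (Finset.sum_mul_sq_le_sq_mul_sq _ _ _)

/-- The vector representing a linear form, in the coordinates of an arbitrary basis. -/
theorem toDual_symm_eq_sum [CompleteSpace F] (b : Module.Basis (Fin d) ℝ F) (l : F →L[ℝ] ℝ) :
    (InnerProductSpace.toDual ℝ F).symm l = ∑ i, (∑ j, (gramOf b)⁻¹ i j * l (b j)) • b i := by
  rw [← b.sum_repr ((InnerProductSpace.toDual ℝ F).symm l)]
  refine Finset.sum_congr rfl fun i _ => ?_
  congr 1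
  rw [← inner_dualVec, real_inner_comm, InnerProductSpace.toDual_symm_apply, dualVec]
  simp

end LinearAlgebra

/-! ### Coordinate frames -/

section

variable {d : ℕ} {M : Type*} [TopologicalSpace M] [ChartedSpace (Euc d) M]

theorem mdifferentiable_of_symm_mem_maximalAtlas {ρ : OpenPartialHomeomorph (Euc d) M}
    (hρ : ρ.symm ∈ IsManifold.maximalAtlas (𝓡 d) ∞ M) : ρ.MDifferentiable (𝓡 d) (𝓡 d) :=
  ⟨(contMDiffOn_symm_of_mem_maximalAtlas hρ).mdifferentiableOn (by simp),
    (contMDiffOn_of_mem_maximalAtlas hρ).mdifferentiableOn (by simp)⟩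

/-- A tangent vector of `ℝᵈ`, regarded as an element of `ℝᵈ`. -/
def toEuc {x : Euc d} (v : TangentSpace (𝓡 d) x) : Euc d := v

/-- The components of a tangent vector in the coordinate frame `dρ_x eᵢ`. -/
def coordComp (ρ : OpenPartialHomeomorph (Euc d) M) {y : M} (v : TangentSpace (𝓡 d) y)
    (i : Fin d) : ℝ :=
  toEuc (mfderiv (𝓡 d) (𝓡 d) ρ.symm y v) i

/-- The `i`-th coordinate form `dxⁱ` of the chart. -/
def coordForm (ρ : OpenPartialHomeomorph (Euc d) M) (y : M) (i : Fin d) :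
    TangentSpace (𝓡 d) y →L[ℝ] ℝ :=
  (EuclideanSpace.proj i : Euc d →L[ℝ] ℝ).comp
    (mfderiv (𝓡 d) (𝓡 d) ρ.symm y : TangentSpace (𝓡 d) y →L[ℝ] Euc d)

theorem coordForm_apply (ρ : OpenPartialHomeomorph (Euc d) M) {y : M}
    (v : TangentSpace (𝓡 d) y) (i : Fin d) : coordForm ρ y i v = coordComp ρ v i := rfl

/-- The coordinate frame `dρ_x eᵢ` as a basis of the tangent space. -/
def coordBasis {ρ : OpenPartialHomeomorph (Euc d) M}
    (hρ : ρ.symm ∈ IsManifold.maximalAtlas (𝓡 d) ∞ M) {x : Euc d} (hx : x ∈ ρ.source) :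
    Module.Basis (Fin d) ℝ (TangentSpace (𝓡 d) (ρ x)) :=
  Module.Basis.ofEquivFun
    (((mdifferentiable_of_symm_mem_maximalAtlas hρ).mfderiv hx).symm.toLinearEquiv.trans
      (EuclideanSpace.equiv (Fin d) ℝ).toLinearEquiv)

theorem coordBasis_apply {ρ : OpenPartialHomeomorph (Euc d) M}
    (hρ : ρ.symm ∈ IsManifold.maximalAtlas (𝓡 d) ∞ M) {x : Euc d} (hx : x ∈ ρ.source)
    (i : Fin d) : coordBasis hρ hx i = coordVec ρ x i := by
  rw [coordBasis, Module.Basis.coe_ofEquivFun]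
  rfl

theorem coordBasis_repr {ρ : OpenPartialHomeomorph (Euc d) M}
    (hρ : ρ.symm ∈ IsManifold.maximalAtlas (𝓡 d) ∞ M) {x : Euc d} (hx : x ∈ ρ.source)
    (v : TangentSpace (𝓡 d) (ρ x)) (i : Fin d) :
    (coordBasis hρ hx).repr v i = coordComp ρ v i := by
  rw [coordBasis, Module.Basis.ofEquivFun_repr_apply]
  rfl

theorem sum_coordComp {ρ : OpenPartialHomeomorph (Euc d) M}
    (hρ : ρ.symm ∈ IsManifold.maximalAtlas (𝓡 d) ∞ M)
    {x : Euc d} (hx : x ∈ ρ.source) (v : TangentSpace (𝓡 d) (ρ x)) :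
    v = ∑ i, coordComp ρ v i • coordVec ρ x i := by
  conv_lhs => rw [← (coordBasis hρ hx).sum_repr v]
  simp only [coordBasis_repr, coordBasis_apply]

theorem mfderiv_symm_coordVec {ρ : OpenPartialHomeomorph (Euc d) M}
    (hρ : ρ.symm ∈ IsManifold.maximalAtlas (𝓡 d) ∞ M) {x : Euc d} (hx : x ∈ ρ.source) (i : Fin d) :
    toEuc (mfderiv (𝓡 d) (𝓡 d) ρ.symm (ρ x) (coordVec ρ x i)) = stdVec i := by
  have := (mdifferentiable_of_symm_mem_maximalAtlas hρ).symm_comp_deriv hx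
  exact congrArg (fun L => toEuc (L (stdVec i))) this

theorem coordComp_coordVec {ρ : OpenPartialHomeomorph (Euc d) M}
    (hρ : ρ.symm ∈ IsManifold.maximalAtlas (𝓡 d) ∞ M) {x : Euc d} (hx : x ∈ ρ.source)
    (i j : Fin d) : coordComp ρ (coordVec ρ x i) j = if j = i then 1 else 0 := by
  rw [coordComp, mfderiv_symm_coordVec hρ hx]
  simp

/-- The `i`-th coordinate vector field on the image of the chart. -/
def coordField (ρ : OpenPartialHomeomorph (Euc d) M) (i : Fin d) (y : M) :
    TangentSpace (𝓡 d) y :=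
  mfderiv (𝓡 d) (𝓡 d) ρ (ρ.symm y) (stdVec i)

theorem coordField_apply (ρ : OpenPartialHomeomorph (Euc d) M) {x : Euc d} (hx : x ∈ ρ.source)
    (i : Fin d) : coordField ρ i (ρ x) = coordVec ρ x i := by
  unfold coordField coordVec
  rw [ρ.left_inv hx]

variable [IsManifold (𝓡 d) ∞ M]

theorem contDiffOn_coordComp {ρ : OpenPartialHomeomorph (Euc d) M}
    (hρ : ρ.symm ∈ IsManifold.maximalAtlas (𝓡 d) ∞ M) {X : (y : M) → TangentSpace (𝓡 d) y}
    (hX : ContMDiffOn (𝓡 d) (𝓡 d).tangent ∞ (fun y => (⟨y, X y⟩ : TangentBundle (𝓡 d) M)) ρ.target)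
    (i : Fin d) : ContDiffOn ℝ ∞ (fun x => coordComp ρ (X (ρ x)) i) ρ.source := by
  -- the components are the fibre part of the tangent map of `ρ.symm` applied to `X`
  have h1 := (contMDiffOn_of_mem_maximalAtlas hρ).contMDiffOn_tangentMapWithin (m := ∞) (by simp)
    ρ.open_target.uniqueMDiffOn
  have h2 := h1.comp hX (fun y hy => by simpa using hy)
  have h3 := h2.comp (contMDiffOn_symm_of_mem_maximalAtlas hρ)
    (fun x hx => ρ.map_source (by simpa using hx))
  have h4 := (contMDiff_snd_tangentBundle_modelSpace (Euc d) (𝓡 d) (n := ∞)).comp_contMDiffOn h3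
  have h5 : ContDiffOn ℝ ∞ (fun x => toEuc (mfderiv (𝓡 d) (𝓡 d) ρ.symm (ρ x) (X (ρ x))))
      ρ.source := by
    refine (contMDiffOn_iff_contDiffOn.1 h4).congr fun x hx => ?_
    have : mfderivWithin (𝓡 d) (𝓡 d) ρ.symm ρ.target (ρ x) = mfderiv (𝓡 d) (𝓡 d) ρ.symm (ρ x) :=
      mfderivWithin_of_isOpen ρ.open_target (ρ.map_source hx)
    exact congrArg (fun L => toEuc (L (X (ρ x)))) this.symm
  exact (contDiff_piLp_apply (p := 2) (i := i)).comp_contDiffOn h5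

theorem contMDiffOn_coordField {ρ : OpenPartialHomeomorph (Euc d) M}
    (hρ : ρ.symm ∈ IsManifold.maximalAtlas (𝓡 d) ∞ M) (i : Fin d) :
    ContMDiffOn (𝓡 d) (𝓡 d).tangent ∞
      (fun y => (⟨y, coordField ρ i y⟩ : TangentBundle (𝓡 d) M)) ρ.target := by
  have h1 := (contMDiffOn_symm_of_mem_maximalAtlas hρ).contMDiffOn_tangentMapWithin (m := ∞)
    (by simp) ρ.open_source.uniqueMDiffOn
  have h0 : ContMDiff (𝓡 d) (𝓡 d).tangent ∞
      (fun x : Euc d => (⟨x, stdVec i⟩ : TangentBundle (𝓡 d) (Euc d))) :=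
    contMDiff_vectorSpace_iff_contDiff.2 contDiff_const
  have h2 := h1.comp (h0.comp_contMDiffOn (contMDiffOn_of_mem_maximalAtlas hρ))
    (fun y hy => by simpa using ρ.map_target (by simpa using hy))
  refine h2.congr fun y hy => ?_
  have hy' : y ∈ ρ.target := hy
  have h3 : mfderivWithin (𝓡 d) (𝓡 d) ρ ρ.source (ρ.symm y) = mfderiv (𝓡 d) (𝓡 d) ρ (ρ.symm y) :=
    mfderivWithin_of_isOpen ρ.open_source (ρ.map_target hy')
  obtain ⟨x, hx, rfl⟩ : ∃ x ∈ ρ.source, ρ x = y := ⟨_, ρ.map_target hy', ρ.right_inv hy'⟩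
  simp only [Function.comp, tangentMapWithin, OpenPartialHomeomorph.symm_symm]
  -- an equality in the total space, since the base points agree only propositionally
  have h4 : (⟨ρ x, coordField ρ i (ρ x)⟩ : TangentBundle (𝓡 d) M) =
    ⟨ρ (ρ.symm (ρ x)), mfderiv (𝓡 d) (𝓡 d) ρ (ρ.symm (ρ x)) (stdVec i)⟩ := by
    rw [coordField_apply ρ hx, ρ.left_inv hx]
    rfl
  rw [h4, ← h3]
  rfl

end

/-! ### The Riemannian measure in a chart -/

section

section

variable {d : ℕ} {M : Type*} [TopologicalSpace M] [MeasurableSpace M] [BorelSpace M]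

/-- Outside its source `ρ` has arbitrary values, so that it is measurable only almost everywhere
for the measure restricted to the source. -/
theorem aemeasurable_chart (ρ : OpenPartialHomeomorph (Euc d) M) :
    AEMeasurable ρ (volume.restrict ρ.source) := by
  rcases isEmpty_or_nonempty M with h | h
  · have : IsEmpty (Euc d) := ⟨fun x => h.elim (ρ x)⟩
    exact (measurable_of_empty _).aemeasurable
  · exact ρ.continuousOn.aemeasurable ρ.open_source.measurableSet

theorem measurableSet_source_inter_preimage (ρ : OpenPartialHomeomorph (Euc d) M) {B : Set M}
    (hB : MeasurableSet B) : MeasurableSet (ρ.source ∩ ρ ⁻¹' B) := by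
  have h : Measurable (ρ.source.domRestrict ρ) := ρ.continuousOn.domRestrict.measurable
  have := ρ.open_source.measurableSet.subtype_image (h hB)
  convert this using 1
  ext x
  simp [and_comm]

end

variable {d : ℕ} {M : Type*} [TopologicalSpace M] [ChartedSpace (Euc d) M]

/-- The derivative of a change of coordinates. -/
theorem hasFDerivAt_transition {ρ σ : OpenPartialHomeomorph (Euc d) M}
    (hρ : ρ.symm ∈ IsManifold.maximalAtlas (𝓡 d) ∞ M)
    (hσ : σ.symm ∈ IsManifold.maximalAtlas (𝓡 d) ∞ M) {x : Euc d} (hx : x ∈ ρ.source)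
    (hxσ : ρ x ∈ σ.target) :
    ∃ L : Euc d →L[ℝ] Euc d, HasFDerivAt (fun z => σ.symm (ρ z)) L x ∧
      ∀ i k, L (stdVec i) k = coordComp σ (coordVec ρ x i) k := by
  have h1 := ((mdifferentiable_of_symm_mem_maximalAtlas hρ).mdifferentiableAt hx).hasMFDerivAt
  have h2 :=
    ((mdifferentiable_of_symm_mem_maximalAtlas hσ).mdifferentiableAt_symm hxσ).hasMFDerivAt
  have h3 := h2.comp x h1
  exact ⟨_, hasMFDerivAt_iff_hasFDerivAt.1 h3, fun i k => rfl⟩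

variable [RiemannianBundle (fun y : M => TangentSpace (𝓡 d) y)]

theorem gramOf_coordBasis {ρ : OpenPartialHomeomorph (Euc d) M}
    (hρ : ρ.symm ∈ IsManifold.maximalAtlas (𝓡 d) ∞ M) {x : Euc d} (hx : x ∈ ρ.source) :
    gramOf (coordBasis hρ hx) = gramMatrix ρ x := by
  ext i j
  simp only [gramOf, gramMatrix, Matrix.of_apply, coordBasis_apply]

theorem gramMatrix_posDef {ρ : OpenPartialHomeomorph (Euc d) M}
    (hρ : ρ.symm ∈ IsManifold.maximalAtlas (𝓡 d) ∞ M) {x : Euc d} (hx : x ∈ ρ.source) :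
    (gramMatrix ρ x).PosDef :=
  gramOf_coordBasis hρ hx ▸ gramOf_posDef _

/-- The Gram matrices of two charts are congruent by the Jacobian matrix of the transition map. -/
theorem det_gramMatrix_transition {ρ σ : OpenPartialHomeomorph (Euc d) M}
    (hσ : σ.symm ∈ IsManifold.maximalAtlas (𝓡 d) ∞ M) {x : Euc d}
    (hxσ : ρ x ∈ σ.target) {L : Euc d →L[ℝ] Euc d}
    (hL : ∀ i k, L (stdVec i) k = coordComp σ (coordVec ρ x i) k) :
    (gramMatrix ρ x).det = L.det ^ 2 * (gramMatrix σ (σ.symm (ρ x))).det := by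
  set A : Matrix (Fin d) (Fin d) ℝ := Matrix.of fun i k => coordComp σ (coordVec ρ x i) k
  have hA : L.det = A.det := by
    rw [ContinuousLinearMap.det,
      ← LinearMap.det_toMatrix (EuclideanSpace.basisFun (Fin d) ℝ).toBasis, ← Matrix.det_transpose]
    congr 1
    ext i k
    simp [LinearMap.toMatrix_apply, A, hL]
  obtain ⟨z, hz, hzx⟩ : ∃ z ∈ σ.source, σ z = ρ x := ⟨_, σ.map_target hxσ, σ.right_inv hxσ⟩
  have hz' : σ.symm (ρ x) = z := by rw [← hzx, σ.left_inv hz]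
  rw [hz']
  have hv : ∀ w w' : TangentSpace (𝓡 d) (ρ x), inner ℝ w w' =
      ∑ k, (∑ l, coordComp σ w l * gramMatrix σ z l k) * coordComp σ w' k := by
    rw [← hzx]
    intro w w'
    conv_lhs => rw [sum_coordComp hσ hz w, sum_coordComp hσ hz w']
    simp only [sum_inner, inner_sum, real_inner_smul_left, real_inner_smul_right, gramMatrix,
      Matrix.of_apply, Finset.sum_mul]
    refine Finset.sum_congr rfl fun k _ => Finset.sum_congr rfl fun l _ => ?_
    rw [real_inner_comm]
    ring
  have hm : gramMatrix ρ x = A * gramMatrix σ z * A.transpose := by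
    ext i j
    simp only [Matrix.mul_apply, Matrix.transpose_apply]
    exact hv _ _
  rw [hm, hA, Matrix.det_mul, Matrix.det_mul, Matrix.det_transpose]
  ring

variable [MeasurableSpace M] [BorelSpace M]

theorem chartVolume_apply (ρ : OpenPartialHomeomorph (Euc d) M) {B : Set M}
    (hB : MeasurableSet B) :
    chartVolume ρ B = ∫⁻ x in ρ.source ∩ ρ ⁻¹' B,
      ENNReal.ofReal (Real.sqrt (gramMatrix ρ x).det) := by
  rw [chartVolume, Measure.map_apply_of_aemeasurable
    ((aemeasurable_chart ρ).mono_ac (withDensity_absolutelyContinuous _ _)) hB,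
    withDensity_apply', Measure.restrict_restrict' ρ.open_source.measurableSet, inter_comm]

/-- The volumes of two charts agree on the overlap; by symmetry one inequality suffices. -/
theorem chartVolume_le_of_subset {ρ σ : OpenPartialHomeomorph (Euc d) M}
    (hρ : ρ.symm ∈ IsManifold.maximalAtlas (𝓡 d) ∞ M)
    (hσ : σ.symm ∈ IsManifold.maximalAtlas (𝓡 d) ∞ M) {B : Set M}
    (hB : MeasurableSet B) (hBρ : B ⊆ ρ.target) : chartVolume σ B ≤ chartVolume ρ B := by
  rw [chartVolume_apply σ hB, chartVolume_apply ρ hB]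
  set S := ρ.source ∩ ρ ⁻¹' (B ∩ σ.target)
  have hS : MeasurableSet S :=
    measurableSet_source_inter_preimage ρ (hB.inter σ.open_target.measurableSet)
  have himg : σ.source ∩ σ ⁻¹' B = (fun z => σ.symm (ρ z)) '' S := by
    ext z
    constructor
    · rintro ⟨hz, hzB⟩
      refine ⟨ρ.symm (σ z), ⟨ρ.map_target (hBρ hzB), ?_, ?_⟩, ?_⟩
      · rw [ρ.right_inv (hBρ hzB)]; exact hzB
      · rw [ρ.right_inv (hBρ hzB)]; exact σ.map_source hz
      · simp only [ρ.right_inv (hBρ hzB), σ.left_inv hz]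
    · rintro ⟨x, ⟨hx, hxB, hxσ⟩, rfl⟩
      refine ⟨σ.map_target hxσ, ?_⟩
      simpa only [mem_preimage, σ.right_inv hxσ] using hxB
  have hd : ∀ x, x ∈ S → ∃ L : Euc d →L[ℝ] Euc d, HasFDerivAt (fun z => σ.symm (ρ z)) L x ∧
      ∀ i k, L (stdVec i) k = coordComp σ (coordVec ρ x i) k :=
    fun x hx => hasFDerivAt_transition hρ hσ hx.1 hx.2.2
  choose! L hL hLc using hd
  have hinj : InjOn (fun z => σ.symm (ρ z)) S := fun x hx y hy h =>
    ρ.injOn hx.1 hy.1 (σ.symm.injOn hx.2.2 hy.2.2 h)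
  rw [himg, lintegral_image_eq_lintegral_abs_det_fderiv_mul _ hS
    (fun x hx => (hL x hx).hasFDerivWithinAt) hinj]
  calc ∫⁻ x in S, ENNReal.ofReal |(L x).det| *
        ENNReal.ofReal (Real.sqrt (gramMatrix σ (σ.symm (ρ x))).det)
      = ∫⁻ x in S, ENNReal.ofReal (Real.sqrt (gramMatrix ρ x).det) := by
        refine setLIntegral_congr_fun hS fun x hx => ?_
        rw [det_gramMatrix_transition hσ hx.2.2 (hLc x hx), Real.sqrt_mul (sq_nonneg _),
          Real.sqrt_sq_eq_abs, ENNReal.ofReal_mul (abs_nonneg _)]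
    _ ≤ _ := lintegral_mono_set
        (show S ⊆ ρ.source ∩ ρ ⁻¹' B from fun x hx => ⟨hx.1, hx.2.1⟩)

/-- In the domain of a chart the Riemannian measure is `√(det g) dx`. -/
theorem riemVolume_restrict_target {ρ : OpenPartialHomeomorph (Euc d) M}
    (hρ : ρ.symm ∈ IsManifold.maximalAtlas (𝓡 d) ∞ M) :
    (riemVolume d M).restrict ρ.target = chartVolume ρ := by
  have hU := ρ.open_target.measurableSet
  have hle : ∀ φ ∈ IsManifold.maximalAtlas (𝓡 d) ∞ M, chartVolume φ.symm ≤ riemVolume d M :=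
    fun φ hφ => le_iSup₂ (f := fun φ (_ : φ ∈ IsManifold.maximalAtlas (𝓡 d) ∞ M) =>
      chartVolume φ.symm) φ hφ
  have hzero : chartVolume ρ ρ.targetᶜ = 0 := by
    rw [chartVolume_apply ρ hU.compl]
    have : ρ.source ∩ ρ ⁻¹' ρ.targetᶜ = ∅ := by
      ext x
      simp only [mem_inter_iff, mem_preimage, mem_compl_iff, mem_empty_iff_false, iff_false,
        not_and, not_not]
      exact fun hx => ρ.map_source hx
    rw [this, Measure.restrict_empty, lintegral_zero_measure]
  have hρle : chartVolume ρ ≤ riemVolume d M := by simpa using hle _ hρ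
  -- the right-hand side is a measure that dominates the volume of every chart
  have hsup : riemVolume d M ≤ chartVolume ρ + (riemVolume d M).restrict ρ.targetᶜ := by
    refine iSup₂_le fun φ hφ => Measure.le_iff.2 fun B hB => ?_
    rw [← measure_inter_add_sdiff B hU, Measure.add_apply, Measure.restrict_apply hB]
    refine add_le_add ?_ ?_
    · exact (chartVolume_le_of_subset hρ (by simpa using hφ) (hB.inter hU)
        inter_subset_right).trans (measure_mono inter_subset_left)
    · rw [sdiff_eq]
      exact hle φ hφ _
  refine le_antisymm ?_ ?_
  · refine (Measure.restrict_mono_measure hsup _).trans ?_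
    rw [Measure.restrict_add, Measure.restrict_restrict hU, inter_compl_self]
    simp [Measure.restrict_le_self]
  · refine Measure.le_iff.2 fun B hB => ?_
    rw [Measure.restrict_apply hB, ← measure_inter_add_sdiff B hU]
    have : chartVolume ρ (B \ ρ.target) = 0 := measure_mono_null (fun y hy => hy.2) hzero
    rw [this, add_zero]
    exact hρle _

end

/-! ### Integration in a chart -/

section

variable {d : ℕ} {M : Type*} [TopologicalSpace M] [ChartedSpace (Euc d) M]
  [RiemannianBundle (fun y : M => TangentSpace (𝓡 d) y)]

/-- The measure `√(det g) dx` on the parameter domain. -/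
def paramVolume (ρ : OpenPartialHomeomorph (Euc d) M) : Measure (Euc d) :=
  (volume.restrict ρ.source).withDensity fun x => ENNReal.ofReal (Real.sqrt (gramMatrix ρ x).det)

variable {ρ : OpenPartialHomeomorph (Euc d) M}

theorem aemeasurable_density (hJ : ContinuousOn (fun x => (gramMatrix ρ x).det) ρ.source) :
    AEMeasurable (fun x => ENNReal.ofReal (Real.sqrt (gramMatrix ρ x).det))
      (volume.restrict ρ.source) :=
  (hJ.sqrt.aemeasurable ρ.open_source.measurableSet).ennreal_ofReal

theorem ae_paramVolume_mem_source (ρ : OpenPartialHomeomorph (Euc d) M) :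
    ∀ᵐ x ∂paramVolume ρ, x ∈ ρ.source :=
  (withDensity_absolutelyContinuous _ _).ae_le (ae_restrict_mem ρ.open_source.measurableSet)

/-- Null sets for `√(det g) dx` are Lebesgue null sets. -/
theorem volume_absolutelyContinuous_paramVolume
    (hρ : ρ.symm ∈ IsManifold.maximalAtlas (𝓡 d) ∞ M)
    (hJ : ContinuousOn (fun x => (gramMatrix ρ x).det) ρ.source) :
    volume.restrict ρ.source ≪ paramVolume ρ := by
  refine withDensity_absolutelyContinuous' (aemeasurable_density hJ) ?_
  filter_upwards [ae_restrict_mem ρ.open_source.measurableSet] with x hx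
  simpa using (gramMatrix_posDef hρ hx).det_pos

variable [MeasurableSpace M] [BorelSpace M]

theorem aemeasurable_chart_paramVolume (ρ : OpenPartialHomeomorph (Euc d) M) :
    AEMeasurable ρ (paramVolume ρ) :=
  (aemeasurable_chart ρ).mono_ac (withDensity_absolutelyContinuous _ _)

theorem map_paramVolume (hρ : ρ.symm ∈ IsManifold.maximalAtlas (𝓡 d) ∞ M) :
    Measure.map ρ (paramVolume ρ) = (riemVolume d M).restrict ρ.target :=
  (riemVolume_restrict_target hρ).symm

theorem aemeasurable_chart_symm (ρ : OpenPartialHomeomorph (Euc d) M) :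
    AEMeasurable ρ.symm ((riemVolume d M).restrict ρ.target) :=
  ρ.continuousOn_symm.aemeasurable ρ.open_target.measurableSet

theorem map_symm_riemVolume (hρ : ρ.symm ∈ IsManifold.maximalAtlas (𝓡 d) ∞ M) :
    Measure.map ρ.symm ((riemVolume d M).restrict ρ.target) = paramVolume ρ := by
  have h := aemeasurable_chart_symm ρ
  rw [← map_paramVolume hρ] at h ⊢
  rw [AEMeasurable.map_map_of_aemeasurable h (aemeasurable_chart_paramVolume ρ)]
  conv_rhs => rw [← Measure.map_id (μ := paramVolume ρ)]
  refine Measure.map_congr ?_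
  filter_upwards [ae_paramVolume_mem_source ρ] with x hx
  exact ρ.left_inv hx

theorem ae_target_iff (hρ : ρ.symm ∈ IsManifold.maximalAtlas (𝓡 d) ∞ M)
    (hJ : ContinuousOn (fun x => (gramMatrix ρ x).det) ρ.source) {p : M → Prop} :
    (∀ᵐ y ∂(riemVolume d M).restrict ρ.target, p y) ↔
      ∀ᵐ x ∂(volume.restrict ρ.source), p (ρ x) := by
  constructor
  · intro h
    rw [← map_paramVolume hρ] at h
    exact (volume_absolutelyContinuous_paramVolume hρ hJ).ae_le
      (ae_of_ae_map (aemeasurable_chart_paramVolume ρ) h)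
  · intro h
    have h' : ∀ᵐ x ∂paramVolume ρ, p (ρ x) := (withDensity_absolutelyContinuous _ _).ae_le h
    rw [← map_symm_riemVolume hρ] at h'
    filter_upwards [ae_of_ae_map (aemeasurable_chart_symm ρ) h',
      ae_restrict_mem ρ.open_target.measurableSet] with y hy hyU
    rwa [ρ.right_inv hyU] at hy

theorem aestronglyMeasurable_target_iff (hρ : ρ.symm ∈ IsManifold.maximalAtlas (𝓡 d) ∞ M)
    (hJ : ContinuousOn (fun x => (gramMatrix ρ x).det) ρ.source) {F : M → ℂ} :
    AEStronglyMeasurable F ((riemVolume d M).restrict ρ.target) ↔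
      AEStronglyMeasurable (fun x => F (ρ x)) (volume.restrict ρ.source) := by
  constructor
  · intro h
    rw [← map_paramVolume hρ] at h
    exact (h.comp_aemeasurable (aemeasurable_chart_paramVolume ρ)).mono_ac
      (volume_absolutelyContinuous_paramVolume hρ hJ)
  · intro h
    have h' : AEStronglyMeasurable (fun x => F (ρ x)) (paramVolume ρ) :=
      h.mono_ac (withDensity_absolutelyContinuous _ _)
    rw [← map_symm_riemVolume hρ] at h'
    refine (h'.comp_aemeasurable (aemeasurable_chart_symm ρ)).congr ?_
    filter_upwards [ae_restrict_mem ρ.open_target.measurableSet] with y hyU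
    simp [ρ.right_inv hyU]

/-- Change of variables for lower integrals; no measurability of `F` is needed. -/
theorem lintegral_target (hρ : ρ.symm ∈ IsManifold.maximalAtlas (𝓡 d) ∞ M)
    (hJ : ContinuousOn (fun x => (gramMatrix ρ x).det) ρ.source) (F : M → ENNReal) :
    ∫⁻ y in ρ.target, F y ∂(riemVolume d M) =
      ∫⁻ x in ρ.source, ENNReal.ofReal (Real.sqrt (gramMatrix ρ x).det) * F (ρ x) := by
  -- transport along a map never increases lower integrals; use this for `ρ` and for its inverse
  have h1 : ∫⁻ y in ρ.target, F y ∂(riemVolume d M) = ∫⁻ x, F (ρ x) ∂(paramVolume ρ) := by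
    refine le_antisymm ?_ ?_
    · rw [← map_paramVolume hρ]
      exact lintegral_map_le _ _
    · rw [← map_symm_riemVolume hρ]
      refine (lintegral_map_le _ _).trans_eq (setLIntegral_congr_fun ρ.open_target.measurableSet
        fun y hy => ?_)
      simp [ρ.right_inv hy]
  rw [h1, paramVolume, lintegral_withDensity_eq_lintegral_mul_non_measurable₀ _
    (aemeasurable_density hJ) (by simp)]
  rfl

theorem setLIntegral_chart (hρ : ρ.symm ∈ IsManifold.maximalAtlas (𝓡 d) ∞ M)
    (hJ : ContinuousOn (fun x => (gramMatrix ρ x).det) ρ.source) {K : Set M}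
    (hK : MeasurableSet K) (hKU : K ⊆ ρ.target) (F : M → ENNReal) :
    ∫⁻ y in K, F y ∂(riemVolume d M) = ∫⁻ x in ρ.source ∩ ρ ⁻¹' K,
      ENNReal.ofReal (Real.sqrt (gramMatrix ρ x).det) * F (ρ x) := by
  have hA := measurableSet_source_inter_preimage ρ hK
  have h := lintegral_target hρ hJ (K.indicator F)
  rw [lintegral_indicator hK, Measure.restrict_restrict hK, inter_eq_left.2 hKU] at h
  rw [h, ← inter_eq_right.2 (inter_subset_left (s := ρ.source) (t := ρ ⁻¹' K)),
    inter_comm, ← Measure.restrict_restrict hA, ← lintegral_indicator hA]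
  refine setLIntegral_congr_fun ρ.open_source.measurableSet fun x hx => ?_
  by_cases hxK : ρ x ∈ K <;> simp [hx, hxK]

/-- Change of variables for Bochner integrals, valid also for functions that are not integrable. -/
theorem integral_target (hρ : ρ.symm ∈ IsManifold.maximalAtlas (𝓡 d) ∞ M)
    (hJ : ContinuousOn (fun x => (gramMatrix ρ x).det) ρ.source) (F : M → ℂ) :
    ∫ y in ρ.target, F y ∂(riemVolume d M) =
      ∫ x in ρ.source, (Real.sqrt (gramMatrix ρ x).det : ℂ) * F (ρ x) := by
  have h1 : ∫ y in ρ.target, F y ∂(riemVolume d M) = ∫ x, F (ρ x) ∂(paramVolume ρ) := by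
    by_cases h : AEStronglyMeasurable F ((riemVolume d M).restrict ρ.target)
    · rw [← map_paramVolume hρ] at h ⊢
      exact integral_map (aemeasurable_chart_paramVolume ρ) h
    -- if one side is not measurable, then neither is the other and both integrals are zero
    · rw [integral_non_aestronglyMeasurable h, integral_non_aestronglyMeasurable]
      rw [aestronglyMeasurable_target_iff hρ hJ] at h
      exact fun h' => h (h'.mono_ac (volume_absolutelyContinuous_paramVolume hρ hJ))
  rw [h1, paramVolume, integral_withDensity_eq_integral_toReal_smul₀ (aemeasurable_density hJ)
    (by simp)]
  refine integral_congr_ae (Filter.Eventually.of_forall fun x => ?_)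
  simp [ENNReal.toReal_ofReal (Real.sqrt_nonneg _)]

end

/-! ### Test functions and weak derivatives on open sets of `ℝᵈ` -/

section FlatTest

variable {d : ℕ} {Ω : Set (Euc d)}

theorem isTestFlat_of_contDiffOn (hΩ : IsOpen Ω) {η : Euc d → ℝ} (hη : ContDiffOn ℝ ∞ η Ω)
    {K : Set (Euc d)} (hK : IsCompact K) (hKΩ : K ⊆ Ω) (h0 : ∀ x ∉ K, η x = 0) :
    IsTestFlat Ω η := by
  refine ⟨contDiff_iff_contDiffAt.2 fun x => ?_, HasCompactSupport.intro hK h0, ?_⟩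
  · by_cases hx : x ∈ Ω
    · exact hη.contDiffAt (hΩ.mem_nhds hx)
    · refine (contDiffAt_const (c := (0 : ℝ))).congr_of_eventuallyEq ?_
      filter_upwards [hK.isClosed.isOpen_compl.mem_nhds fun h => hx (hKΩ h)] with z hz
      exact h0 z hz
  · refine (closure_minimal ?_ hK.isClosed).trans hKΩ
    exact fun x hx => by_contra fun h => hx (h0 x h)

theorem IsTestFlat.eq_zero {η : Euc d → ℝ} (hη : IsTestFlat Ω η) {x : Euc d} (hx : x ∉ Ω) :
    η x = 0 :=
  image_eq_zero_of_notMem_tsupport fun h => hx (hη.2.2 h)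

theorem IsTestFlat.pderiv {η : Euc d → ℝ} (hη : IsTestFlat Ω η) (i : Fin d) :
    IsTestFlat Ω (RubberBand.pderiv i η) :=
  ⟨(hη.1.fderiv_right (m := ∞) (by simp)).clm_apply contDiff_const,
    hη.2.1.fderiv_apply (𝕜 := ℝ) _, (tsupport_fderiv_apply_subset ℝ _).trans hη.2.2⟩

theorem IsTestFlat.integrable_mul {η ζ : Euc d → ℝ} (hη : IsTestFlat Ω η)
    (hζ : IsTestFlat Ω ζ) : Integrable fun x => η x * ζ x :=
  (hη.1.continuous.mul hζ.1.continuous).integrable_of_hasCompactSupport hη.2.1.mul_right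

theorem IsTestFlat.integral_mul_pderiv {η ζ : Euc d → ℝ} (hη : IsTestFlat Ω η)
    (hζ : IsTestFlat Ω ζ) (i : Fin d) :
    ∫ x, η x * RubberBand.pderiv i ζ x = -∫ x, RubberBand.pderiv i η x * ζ x :=
  integral_mul_fderiv_eq_neg_fderiv_mul_of_integrable ((hη.pderiv i).integrable_mul hζ)
    (hη.integrable_mul (hζ.pderiv i)) (hη.integrable_mul hζ)
    (fun x _ => hη.1.differentiable (by simp) x) (fun x _ => hζ.1.differentiable (by simp) x)

/-- A smooth compactly supported field has its classical divergence as weak divergence. -/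
theorem hasWeakDivFlat_of_isTestFlat {ζ : Fin d → Euc d → ℝ} (hζ : ∀ i, IsTestFlat Ω (ζ i)) :
    HasWeakDivFlat Ω (fun x i => (ζ i x : ℂ)) (fun x => ((∑ i, pderiv i (ζ i) x : ℝ) : ℂ)) := by
  intro η hη
  have h : ∫ x, ∑ i, ζ i x * pderiv i η x = -∫ x, (∑ i, pderiv i (ζ i) x) * η x := by
    simp_rw [Finset.sum_mul]
    rw [integral_finsetSum _ fun i _ => (hζ i).integrable_mul (hη.pderiv i),
      integral_finsetSum _ fun i _ => ((hζ i).pderiv i).integrable_mul hη, ← Finset.sum_neg_distrib]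
    exact Finset.sum_congr rfl fun i _ => (hζ i).integral_mul_pderiv hη i
  rw [setIntegral_eq_integral_of_forall_compl_eq_zero,
    setIntegral_eq_integral_of_forall_compl_eq_zero]
  · simp only
    exact_mod_cast congrArg (fun r : ℝ => (r : ℂ)) h
  · intro x hx
    simp [hη.eq_zero hx]
  · intro x hx
    simp [(hζ _).eq_zero hx]

theorem integrableOn_mul_test {f : Euc d → ℂ}
    (hf : LocallyIntegrableOn f Ω) {η : Euc d → ℝ} (hη : IsTestFlat Ω η) :
    IntegrableOn (fun x => f x * (η x : ℂ)) Ω := by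
  have h1 : IntegrableOn (fun x => f x * (η x : ℂ)) (tsupport η) :=
    (hf.integrableOn_compact_subset hη.2.2 hη.2.1).mul_continuousOn
      (Complex.continuous_ofReal.comp hη.1.continuous).continuousOn hη.2.1
  refine ((integrableOn_iff_integrable_of_support_subset ?_).1 h1).integrableOn
  intro x hx
  refine subset_tsupport _ fun h => hx ?_
  simp [h]

/-- The weak divergence is unique. -/
theorem HasWeakDivFlat.ae_eq (hΩ : IsOpen Ω) {F : Euc d → Fin d → ℂ} {h₁ h₂ : Euc d → ℂ}
    (H₁ : HasWeakDivFlat Ω F h₁) (H₂ : HasWeakDivFlat Ω F h₂) (hh₁ : LocallyIntegrableOn h₁ Ω)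
    (hh₂ : LocallyIntegrableOn h₂ Ω) : h₁ =ᵐ[volume.restrict Ω] h₂ := by
  have h := hΩ.ae_eq_zero_of_integral_contDiff_smul_eq_zero (hh₁.sub hh₂) fun η h1 h2 h3 => by
    have hη : IsTestFlat Ω η := ⟨h1, h2, h3⟩
    rw [← setIntegral_eq_integral_of_forall_compl_eq_zero (s := Ω)
      (fun x hx => by simp [hη.eq_zero hx])]
    have e : ∀ x, η x • (h₁ - h₂) x = h₁ x * (η x : ℂ) - h₂ x * (η x : ℂ) := by
      intro x
      simp only [Pi.sub_apply, Complex.real_smul]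
      ring
    simp_rw [e]
    rw [integral_sub (integrableOn_mul_test hh₁ hη)
      (integrableOn_mul_test hh₂ hη), sub_eq_zero]
    exact neg_injective ((H₁ η hη).symm.trans (H₂ η hη))
  rw [Filter.EventuallyEq, ae_restrict_iff' hΩ.measurableSet]
  filter_upwards [h] with x hx hxΩ
  exact sub_eq_zero.1 (hx hxΩ)

theorem HasWeakDivFlat.congr (hΩ : IsOpen Ω) {F F' : Euc d → Fin d → ℂ} {h h' : Euc d → ℂ}
    (hF : ∀ x ∈ Ω, F x = F' x) (hh : ∀ x ∈ Ω, h x = h' x) (H : HasWeakDivFlat Ω F h) :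
    HasWeakDivFlat Ω F' h' := by
  intro η hη
  have e1 : ∫ x in Ω, ∑ i, F x i * (pderiv i η x : ℂ) =
      ∫ x in Ω, ∑ i, F' x i * (pderiv i η x : ℂ) :=
    setIntegral_congr_fun hΩ.measurableSet fun x hx => by simp only [hF x hx]
  have e2 : ∫ x in Ω, h x * (η x : ℂ) = ∫ x in Ω, h' x * (η x : ℂ) :=
    setIntegral_congr_fun hΩ.measurableSet fun x hx => by simp only [hh x hx]
  rw [← e1, ← e2]
  exact H η hη

/-- A function that is locally square integrable for a positive continuous weight is locally
integrable. -/
theorem locallyIntegrableOn_of_weighted (hΩ : IsOpen Ω) {f : Euc d → ℂ} {w : Euc d → ℝ}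
    (hf : AEStronglyMeasurable f (volume.restrict Ω)) (hw : ContinuousOn w Ω)
    (hpos : ∀ x ∈ Ω, 0 < w x)
    (hfin : ∀ K ⊆ Ω, IsCompact K → ∫⁻ x in K, ENNReal.ofReal (‖f x‖ ^ 2 * w x) < ⊤) :
    LocallyIntegrableOn f Ω := by
  refine (locallyIntegrableOn_iff hΩ.isLocallyClosed).2 fun K hKΩ hK => ⟨hf.mono_set hKΩ, ?_⟩
  rcases K.eq_empty_or_nonempty with rfl | hne
  · simp [HasFiniteIntegral]
  obtain ⟨z, hz, hmin⟩ := hK.exists_isMinOn hne (hw.mono hKΩ)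
  have hc := hpos z (hKΩ hz)
  -- `|f| ≤ 1 + |f|²`, and `w ≥ w z` on `K`
  have hle : ∀ x ∈ K, ‖f x‖ₑ ≤
      1 + ENNReal.ofReal (w z)⁻¹ * ENNReal.ofReal (‖f x‖ ^ 2 * w x) := by
    intro x hx
    rw [← ENNReal.ofReal_mul (by positivity), ← ENNReal.ofReal_one,
      ← ENNReal.ofReal_add zero_le_one (by have := hpos x (hKΩ hx); positivity), ← ofReal_norm]
    refine ENNReal.ofReal_le_ofReal ?_
    have h1 : ‖f x‖ ^ 2 ≤ (w z)⁻¹ * (‖f x‖ ^ 2 * w x) := by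
      rw [le_inv_mul_iff₀ hc, mul_comm]
      exact mul_le_mul_of_nonneg_left (hmin hx) (by positivity)
    nlinarith [sq_nonneg (‖f x‖ - 1)]
  refine (setLIntegral_mono_ae' hK.measurableSet (Filter.Eventually.of_forall hle)).trans_lt ?_
  rw [lintegral_add_left measurable_const, lintegral_const_mul' _ _ (by simp)]
  refine ENNReal.add_lt_top.2 ⟨?_, ENNReal.mul_lt_top (by simp) (hfin K hKΩ hK)⟩
  simpa using hK.measure_lt_top

end FlatTest

/-! ### Test functions in a chart -/

section Transfer

variable {d : ℕ} {M : Type*} [TopologicalSpace M]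

/-- The function `f` on the parameter domain, transported to `M` and extended by zero. -/
def pushFun (ρ : OpenPartialHomeomorph (Euc d) M) (f : Euc d → ℝ) : M → ℝ :=
  ρ.target.indicator fun y => f (ρ.symm y)

/-- The function `φ` on `M`, pulled back to the parameter domain and extended by zero. -/
def pullFun (ρ : OpenPartialHomeomorph (Euc d) M) (φ : M → ℝ) : Euc d → ℝ :=
  ρ.source.indicator fun x => φ (ρ x)

theorem pushFun_apply (ρ : OpenPartialHomeomorph (Euc d) M) (f : Euc d → ℝ) {x : Euc d}
    (hx : x ∈ ρ.source) : pushFun ρ f (ρ x) = f x := by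
  rw [pushFun, indicator_of_mem (ρ.map_source hx), ρ.left_inv hx]

theorem pullFun_apply (ρ : OpenPartialHomeomorph (Euc d) M) (φ : M → ℝ) {x : Euc d}
    (hx : x ∈ ρ.source) : pullFun ρ φ x = φ (ρ x) :=
  indicator_of_mem hx _

theorem isCompact_image_chart (ρ : OpenPartialHomeomorph (Euc d) M) {K : Set (Euc d)}
    (hK : IsCompact K) (hKV : K ⊆ ρ.source) : IsCompact (ρ '' K) :=
  hK.image_of_continuousOn (ρ.continuousOn.mono hKV)

theorem isCompact_image_chart_symm (ρ : OpenPartialHomeomorph (Euc d) M) {K : Set M}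
    (hK : IsCompact K) (hKU : K ⊆ ρ.target) : IsCompact (ρ.symm '' K) :=
  hK.image_of_continuousOn (ρ.continuousOn_symm.mono hKU)

theorem image_chart_subset (ρ : OpenPartialHomeomorph (Euc d) M) {K : Set (Euc d)}
    (hKV : K ⊆ ρ.source) : ρ '' K ⊆ ρ.target :=
  image_subset_iff.2 fun _ hx => ρ.map_source (hKV hx)

theorem image_chart_symm_subset (ρ : OpenPartialHomeomorph (Euc d) M) {K : Set M}
    (hKU : K ⊆ ρ.target) : ρ.symm '' K ⊆ ρ.source :=
  image_subset_iff.2 fun _ hx => ρ.map_target (hKU hx)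

variable [ChartedSpace (Euc d) M]

theorem isTest_of_contMDiffOn [T2Space M] {U : Set M} (hU : IsOpen U) {φ : M → ℝ}
    (hφ : ContMDiffOn (𝓡 d) 𝓘(ℝ, ℝ) ∞ φ U) {K : Set M} (hK : IsCompact K) (hKU : K ⊆ U)
    (h0 : ∀ y ∉ K, φ y = 0) : IsTest (d := d) U φ := by
  refine ⟨fun y => ?_, HasCompactSupport.intro hK h0, ?_⟩
  · by_cases hy : y ∈ U
    · exact hφ.contMDiffAt (hU.mem_nhds hy)
    · refine (contMDiffAt_const (c := (0 : ℝ))).congr_of_eventuallyEq ?_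
      filter_upwards [hK.isClosed.isOpen_compl.mem_nhds fun h => hy (hKU h)] with z hz
      exact h0 z hz
  · refine (closure_minimal ?_ hK.isClosed).trans hKU
    exact fun y hy => by_contra fun h => hy (h0 y h)

theorem isTestField_of_contMDiffOn [IsManifold (𝓡 d) ∞ M] [T2Space M] {U : Set M} (hU : IsOpen U)
    {X : (y : M) → TangentSpace (𝓡 d) y}
    (hX : ContMDiffOn (𝓡 d) (𝓡 d).tangent ∞ (fun y => (⟨y, X y⟩ : TangentBundle (𝓡 d) M)) U)
    {K : Set M} (hK : IsCompact K) (hKU : K ⊆ U)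
    (h0 : ∀ y ∉ K, X y = 0) : IsTestField U X := by
  refine ⟨fun y => ?_, K, hKU, hK, h0⟩
  by_cases hy : y ∈ U
  · exact hX.contMDiffAt (hU.mem_nhds hy)
  · refine (contMDiff_zeroSection ℝ (fun y : M => TangentSpace (𝓡 d) y) y).congr_of_eventuallyEq ?_
    filter_upwards [hK.isClosed.isOpen_compl.mem_nhds fun h => hy (hKU h)] with z hz
    simp [zeroSection, h0 z hz]

variable {ρ : OpenPartialHomeomorph (Euc d) M}

theorem contMDiffOn_comp_symm (hρ : ρ.symm ∈ IsManifold.maximalAtlas (𝓡 d) ∞ M) {f : Euc d → ℝ}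
    (hf : ContDiffOn ℝ ∞ f ρ.source) :
    ContMDiffOn (𝓡 d) 𝓘(ℝ, ℝ) ∞ (fun y => f (ρ.symm y)) ρ.target :=
  hf.contMDiffOn.comp (contMDiffOn_of_mem_maximalAtlas hρ) fun _ hy => ρ.map_target hy

theorem contDiffOn_comp_chart (hρ : ρ.symm ∈ IsManifold.maximalAtlas (𝓡 d) ∞ M) {φ : M → ℝ}
    (hφ : ContMDiff (𝓡 d) 𝓘(ℝ, ℝ) ∞ φ) : ContDiffOn ℝ ∞ (fun x => φ (ρ x)) ρ.source :=
  contMDiffOn_iff_contDiffOn.1 (hφ.comp_contMDiffOn (contMDiffOn_symm_of_mem_maximalAtlas hρ))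

theorem isTest_pushFun [T2Space M] (hρ : ρ.symm ∈ IsManifold.maximalAtlas (𝓡 d) ∞ M)
    {f : Euc d → ℝ} (hf : ContDiffOn ℝ ∞ f ρ.source) {K : Set (Euc d)} (hK : IsCompact K)
    (hKV : K ⊆ ρ.source) (h0 : ∀ x ∉ K, f x = 0) : IsTest (d := d) ρ.target (pushFun ρ f) := by
  refine isTest_of_contMDiffOn ρ.open_target ((contMDiffOn_comp_symm hρ hf).congr fun y hy =>
    indicator_of_mem hy _) (isCompact_image_chart ρ hK hKV) (image_chart_subset ρ hKV)
    fun y hy => ?_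
  by_cases hyU : y ∈ ρ.target
  · rw [pushFun, indicator_of_mem hyU]
    exact h0 _ fun h => hy ⟨_, h, ρ.right_inv hyU⟩
  · exact indicator_of_notMem hyU _

theorem isTestFlat_pullFun (hρ : ρ.symm ∈ IsManifold.maximalAtlas (𝓡 d) ∞ M) {φ : M → ℝ}
    (hφ : IsTest (d := d) ρ.target φ) : IsTestFlat ρ.source (pullFun ρ φ) := by
  refine isTestFlat_of_contDiffOn ρ.open_source ((contDiffOn_comp_chart hρ hφ.1).congr
    fun x hx => indicator_of_mem hx _) (isCompact_image_chart_symm ρ hφ.2.1 hφ.2.2)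
    (image_chart_symm_subset ρ hφ.2.2) fun x hx => ?_
  by_cases hxV : x ∈ ρ.source
  · rw [pullFun_apply ρ φ hxV]
    exact image_eq_zero_of_notMem_tsupport fun h => hx ⟨_, h, ρ.left_inv hxV⟩
  · exact indicator_of_notMem hxV _

theorem pderiv_eq_mfderiv (hρ : ρ.symm ∈ IsManifold.maximalAtlas (𝓡 d) ∞ M) {φ : M → ℝ}
    (hφ : ContMDiff (𝓡 d) 𝓘(ℝ, ℝ) ∞ φ) {η : Euc d → ℝ} (hηφ : ∀ x ∈ ρ.source, φ (ρ x) = η x)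
    {x : Euc d} (hx : x ∈ ρ.source) (i : Fin d) :
    (mfderiv (𝓡 d) 𝓘(ℝ, ℝ) φ (ρ x) : TangentSpace (𝓡 d) (ρ x) →L[ℝ] ℝ) (coordVec ρ x i) =
      pderiv i η x := by
  have h1 := ((mdifferentiable_of_symm_mem_maximalAtlas hρ).mdifferentiableAt hx).hasMFDerivAt
  have h2 := (hφ.mdifferentiable (by simp) (ρ x)).hasMFDerivAt
  have h3 := h2.comp x h1
  obtain ⟨L, hL, hLi⟩ : ∃ L : Euc d →L[ℝ] ℝ, HasFDerivAt (φ ∘ ρ) L x ∧ L (stdVec i) =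
      (mfderiv (𝓡 d) 𝓘(ℝ, ℝ) φ (ρ x) : TangentSpace (𝓡 d) (ρ x) →L[ℝ] ℝ) (coordVec ρ x i) :=
    ⟨_, hasMFDerivAt_iff_hasFDerivAt.1 h3, rfl⟩
  have h4 : HasFDerivAt η L x := hL.congr_of_eventuallyEq
    (Filter.eventuallyEq_of_mem (ρ.open_source.mem_nhds hx) fun z hz => (hηφ z hz).symm)
  rw [← hLi, pderiv, h4.fderiv]

variable [RiemannianBundle (fun y : M => TangentSpace (𝓡 d) y)]

/-- The pairing of a 1-form with a gradient, in coordinates. -/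
theorem form_riemGrad (hρ : ρ.symm ∈ IsManifold.maximalAtlas (𝓡 d) ∞ M) {φ : M → ℝ}
    (hφ : ContMDiff (𝓡 d) 𝓘(ℝ, ℝ) ∞ φ) {η : Euc d → ℝ} (hηφ : ∀ x ∈ ρ.source, φ (ρ x) = η x)
    {x : Euc d} (hx : x ∈ ρ.source) (α : TangentSpace (𝓡 d) (ρ x) →L[ℝ] ℂ) :
    α (riemGrad φ (ρ x)) =
      ∑ i, applyW (gramMatrix ρ x)⁻¹ (fun j => α (coordVec ρ x j)) i * (pderiv i η x : ℂ) := by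
  have : FiniteDimensional ℝ (TangentSpace (𝓡 d) (ρ x)) :=
    inferInstanceAs (FiniteDimensional ℝ (Euc d))
  have : CompleteSpace (TangentSpace (𝓡 d) (ρ x)) := FiniteDimensional.complete ℝ _
  have h : riemGrad φ (ρ x) =
      ∑ i, (∑ j, (gramMatrix ρ x)⁻¹ i j * pderiv j η x) • coordVec ρ x i := by
    simp_rw [← pderiv_eq_mfderiv hρ hφ hηφ hx, ← gramOf_coordBasis hρ hx, ← coordBasis_apply hρ hx]
    exact toDual_symm_eq_sum (coordBasis hρ hx) _
  have hs : (gramMatrix ρ x)⁻¹.IsSymm := by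
    rw [← gramOf_coordBasis hρ hx]
    exact (gramOf_isSymm _).inv
  rw [h, map_sum]
  simp only [map_smul, Complex.real_smul, Complex.ofReal_sum, Complex.ofReal_mul, Finset.sum_mul,
    applyW]
  rw [Finset.sum_comm]
  refine Finset.sum_congr rfl fun j _ => Finset.sum_congr rfl fun i _ => ?_
  rw [hs.apply i j]
  ring

end Transfer

/-! ### The divergence and the gradient in coordinates -/

section Operators

variable {d : ℕ} {M : Type*} [TopologicalSpace M] [ChartedSpace (Euc d) M]
  [RiemannianBundle (fun y : M => TangentSpace (𝓡 d) y)]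
  {ρ : OpenPartialHomeomorph (Euc d) M}

theorem sqrt_det_gramMatrix_pos (hρ : ρ.symm ∈ IsManifold.maximalAtlas (𝓡 d) ∞ M) {x : Euc d}
    (hx : x ∈ ρ.source) : 0 < Real.sqrt (gramMatrix ρ x).det :=
  Real.sqrt_pos.2 (gramMatrix_posDef hρ hx).det_pos

theorem contDiffOn_sqrt_det_gramMatrix (hρ : ρ.symm ∈ IsManifold.maximalAtlas (𝓡 d) ∞ M)
    (hJ : ContDiffOn ℝ ∞ (fun x => (gramMatrix ρ x).det) ρ.source) :
    ContDiffOn ℝ ∞ (fun x => Real.sqrt (gramMatrix ρ x).det) ρ.source :=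
  hJ.sqrt fun _ hx => (gramMatrix_posDef hρ hx).det_pos.ne'

/-- Raising the index of `⟨X, ·⟩` returns the components of `X`. -/
theorem applyW_inv_flatForm (hρ : ρ.symm ∈ IsManifold.maximalAtlas (𝓡 d) ∞ M)
    (X : (y : M) → TangentSpace (𝓡 d) y) {x : Euc d} (hx : x ∈ ρ.source) (i : Fin d) :
    applyW (gramMatrix ρ x)⁻¹ (fun j => flatForm X (ρ x) (coordVec ρ x j)) i =
      (coordComp ρ (X (ρ x)) i : ℂ) := by
  have h : ∀ j, flatForm X (ρ x) (coordVec ρ x j) =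
      ((inner ℝ (X (ρ x)) (coordVec ρ x j) : ℝ) : ℂ) := fun j => rfl
  simp only [applyW, h, ← Complex.ofReal_mul, ← Complex.ofReal_sum]
  congr 1
  simp only [← coordBasis_apply hρ hx, ← gramOf_coordBasis hρ hx, ← coordBasis_repr hρ hx,
    ← inner_dualVec]
  rw [dualVec, sum_inner]
  refine Finset.sum_congr rfl fun j _ => ?_
  rw [real_inner_smul_left, real_inner_comm]

variable [MeasurableSpace M] [BorelSpace M]

/-- The distributional divergence on `M` in coordinates, `div α = (1/√g) ∂ᵢ(√g gⁱʲ αⱼ)`. -/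
theorem hasWeakDivM_iff [T2Space M] (hρ : ρ.symm ∈ IsManifold.maximalAtlas (𝓡 d) ∞ M)
    (hJ : ContDiffOn ℝ ∞ (fun x => (gramMatrix ρ x).det) ρ.source) (α : CForm d M) (h : M → ℂ) :
    HasWeakDivM ρ.target α h ↔ HasWeakDivFlat ρ.source
      (fun x i => (Real.sqrt (gramMatrix ρ x).det : ℂ) *
        applyW (gramMatrix ρ x)⁻¹ (fun j => α (ρ x) (coordVec ρ x j)) i)
      (fun x => (Real.sqrt (gramMatrix ρ x).det : ℂ) * h (ρ x)) := by
  -- the two identities agree for each pair of corresponding test functions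
  have key : ∀ (φ : M → ℝ) (η : Euc d → ℝ), IsTest (d := d) ρ.target φ →
      (∀ x ∈ ρ.source, φ (ρ x) = η x) →
      ((∫ y in ρ.target, α y (riemGrad φ y) ∂(riemVolume d M) =
        -∫ y in ρ.target, h y * (φ y : ℂ) ∂(riemVolume d M)) ↔
      (∫ x in ρ.source, ∑ i, ((Real.sqrt (gramMatrix ρ x).det : ℂ) *
        applyW (gramMatrix ρ x)⁻¹ (fun j => α (ρ x) (coordVec ρ x j)) i) * (pderiv i η x : ℂ) =
        -∫ x in ρ.source, ((Real.sqrt (gramMatrix ρ x).det : ℂ) * h (ρ x)) * (η x : ℂ))) := by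
    intro φ η hφ hηφ
    have e1 : ∫ x in ρ.source, (Real.sqrt (gramMatrix ρ x).det : ℂ) * α (ρ x) (riemGrad φ (ρ x)) =
        ∫ x in ρ.source, ∑ i, ((Real.sqrt (gramMatrix ρ x).det : ℂ) *
          applyW (gramMatrix ρ x)⁻¹ (fun j => α (ρ x) (coordVec ρ x j)) i) *
            (pderiv i η x : ℂ) :=
      setIntegral_congr_fun ρ.open_source.measurableSet fun x hx => by
        simp only [form_riemGrad hρ hφ.1 hηφ hx, Finset.mul_sum, mul_assoc]
    have e2 : ∫ x in ρ.source, (Real.sqrt (gramMatrix ρ x).det : ℂ) *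
          (h (ρ x) * (φ (ρ x) : ℂ)) =
        ∫ x in ρ.source, ((Real.sqrt (gramMatrix ρ x).det : ℂ) * h (ρ x)) * (η x : ℂ) :=
      setIntegral_congr_fun ρ.open_source.measurableSet fun x hx => by
        simp only [hηφ x hx, mul_assoc]
    rw [integral_target hρ hJ.continuousOn, integral_target hρ hJ.continuousOn, e1, e2]
  constructor
  · intro H η hη
    have hφ := isTest_pushFun hρ hη.1.contDiffOn hη.2.1 hη.2.2
      (fun x hx => image_eq_zero_of_notMem_tsupport hx)
    exact (key _ η hφ fun x hx => pushFun_apply ρ η hx).1 (H _ hφ)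
  · intro H φ hφ
    exact (key φ _ hφ fun x hx => (pullFun_apply ρ φ hx).symm).2 (H _ (isTestFlat_pullFun hρ hφ))

theorem hasWeakDivM_flatForm_iff [T2Space M] (hρ : ρ.symm ∈ IsManifold.maximalAtlas (𝓡 d) ∞ M)
    (hJ : ContDiffOn ℝ ∞ (fun x => (gramMatrix ρ x).det) ρ.source)
    (X : (y : M) → TangentSpace (𝓡 d) y) (h : M → ℂ) {ζ : Euc d → Fin d → ℂ} {k : Euc d → ℂ}
    (hζ : ∀ x ∈ ρ.source, ∀ i,
      ζ x i = (Real.sqrt (gramMatrix ρ x).det : ℂ) * (coordComp ρ (X (ρ x)) i : ℂ))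
    (hk : ∀ x ∈ ρ.source, k x = (Real.sqrt (gramMatrix ρ x).det : ℂ) * h (ρ x)) :
    HasWeakDivM ρ.target (flatForm X) h ↔ HasWeakDivFlat ρ.source ζ k := by
  rw [hasWeakDivM_iff hρ hJ]
  have e : ∀ x ∈ ρ.source, (fun i => (Real.sqrt (gramMatrix ρ x).det : ℂ) *
      applyW (gramMatrix ρ x)⁻¹ (fun j => flatForm X (ρ x) (coordVec ρ x j)) i) = ζ x := by
    intro x hx
    funext i
    rw [applyW_inv_flatForm hρ X hx, hζ x hx]
  exact ⟨HasWeakDivFlat.congr ρ.open_source e fun x hx => (hk x hx).symm,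
    HasWeakDivFlat.congr ρ.open_source (fun x hx => (e x hx).symm) hk⟩

variable [IsManifold (𝓡 d) ∞ M]

/-- For the test field `(η / √g) ∂ᵢ`, whose divergence is `(∂ᵢ η) / √g`, the defining identity of
the gradient on `M` is the one of the `i`-th partial derivative. -/
theorem HasWeakGradM.flat [T2Space M] (hρ : ρ.symm ∈ IsManifold.maximalAtlas (𝓡 d) ∞ M)
    (hJ : ContDiffOn ℝ ∞ (fun x => (gramMatrix ρ x).det) ρ.source) {u : M → ℂ} {α : CForm d M}
    (H : HasWeakGradM ρ.target u α) :
    HasWeakGradFlat ρ.source (fun x => u (ρ x)) (fun x i => α (ρ x) (coordVec ρ x i)) := by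
  intro η hη i
  have hs := contDiffOn_sqrt_det_gramMatrix hρ hJ
  have hs0 : ∀ x ∈ ρ.source, Real.sqrt (gramMatrix ρ x).det ≠ 0 :=
    fun x hx => (sqrt_det_gramMatrix_pos hρ hx).ne'
  set a : Euc d → ℝ := fun x => η x / Real.sqrt (gramMatrix ρ x).det with ha
  set b : Euc d → ℝ := fun x => pderiv i η x / Real.sqrt (gramMatrix ρ x).det with hb
  have hη0 : ∀ x ∉ tsupport η, η x = 0 := fun x hx => image_eq_zero_of_notMem_tsupport hx
  have hη' := hη.pderiv i
  have haT := isTest_pushFun hρ (f := a) (hη.1.contDiffOn.div hs hs0) hη.2.1 hη.2.2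
    (fun x hx => by simp [ha, hη0 x hx])
  have hbT := isTest_pushFun hρ (f := b) (hη'.1.contDiffOn.div hs hs0) hη'.2.1 hη'.2.2
    (fun x hx => by simp [hb, image_eq_zero_of_notMem_tsupport hx])
  set X : (y : M) → TangentSpace (𝓡 d) y := fun y => pushFun ρ a y • coordField ρ i y with hX
  have hXx : ∀ x ∈ ρ.source, X (ρ x) = a x • coordVec ρ x i := fun x hx => by
    simp only [hX, pushFun_apply ρ a hx, coordField_apply ρ hx]
  have hXT : IsTestField ρ.target X := by
    refine isTestField_of_contMDiffOn ρ.open_target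
      (haT.1.contMDiffOn.smul_section (contMDiffOn_coordField hρ i)) haT.2.1 haT.2.2 fun y hy => ?_
    simp only [hX, image_eq_zero_of_notMem_tsupport hy, zero_smul]
  have hc : ∀ x ∈ ρ.source, ∀ j, coordComp ρ (X (ρ x)) j = if j = i then a x else 0 := by
    intro x hx j
    rw [hXx x hx, ← coordBasis_repr hρ hx, map_smul, Finsupp.smul_apply, coordBasis_repr hρ hx,
      coordComp_coordVec hρ hx]
    split_ifs <;> simp
  have hζ : ∀ j, IsTestFlat ρ.source (fun x => if j = i then η x else 0) := by
    intro j
    by_cases hj : j = i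
    · simpa [hj] using hη
    · simp only [hj, if_false]
      exact isTestFlat_of_contDiffOn ρ.open_source contDiffOn_const isCompact_empty
        (empty_subset _) fun _ _ => rfl
  -- in coordinates the field `√g X` is `η eᵢ`, and `√g` times the pushed forward function is `∂ᵢη`
  have hdiv : HasWeakDivM ρ.target (flatForm X) (fun y => (pushFun ρ b y : ℂ)) := by
    refine (hasWeakDivM_flatForm_iff hρ hJ X _ (fun x hx j => ?_) (fun x hx => ?_)).2
      (hasWeakDivFlat_of_isTestFlat hζ)
    · rw [hc x hx]
      split_ifs
      · rw [← Complex.ofReal_mul, ha, mul_div_cancel₀ _ (hs0 x hx)]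
      · simp
    · rw [pushFun_apply ρ b hx, ← Complex.ofReal_mul, hb, mul_div_cancel₀ _ (hs0 x hx),
        Finset.sum_eq_single i]
      · simp
      · intro j _ hj
        simp [hj, pderiv]
      · simp
  have hmain := H X _ hXT hbT hdiv
  rw [integral_target hρ hJ.continuousOn, integral_target hρ hJ.continuousOn] at hmain
  have e1 : ∫ x in ρ.source, (Real.sqrt (gramMatrix ρ x).det : ℂ) *
      (u (ρ x) * (pushFun ρ b (ρ x) : ℂ)) = ∫ x in ρ.source, u (ρ x) * (pderiv i η x : ℂ) :=
    setIntegral_congr_fun ρ.open_source.measurableSet fun x hx => by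
      have := Complex.ofReal_ne_zero.2 (hs0 x hx)
      simp only [pushFun_apply ρ b hx]
      simp only [hb, Complex.ofReal_div]
      field_simp
  have e2 : ∫ x in ρ.source, (Real.sqrt (gramMatrix ρ x).det : ℂ) * α (ρ x) (X (ρ x)) =
      ∫ x in ρ.source, α (ρ x) (coordVec ρ x i) * (η x : ℂ) :=
    setIntegral_congr_fun ρ.open_source.measurableSet fun x hx => by
      have := Complex.ofReal_ne_zero.2 (hs0 x hx)
      simp only [hXx x hx, ha, map_smul, Complex.real_smul, Complex.ofReal_div]
      field_simp
  rw [← e1, ← e2]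
  exact hmain

/-- For a test field `X` the functions `√g Xⁱ` are test functions, and `√g div X = ∑ᵢ ∂ᵢ(√g Xⁱ)` by
uniqueness of the weak divergence; summing the identities of the partial derivatives gives the
identity on `M`. -/
theorem HasWeakGradFlat.manifold [T2Space M] (hρ : ρ.symm ∈ IsManifold.maximalAtlas (𝓡 d) ∞ M)
    (hJ : ContDiffOn ℝ ∞ (fun x => (gramMatrix ρ x).det) ρ.source) {u : M → ℂ} {α : CForm d M}
    (hu : LocallyIntegrableOn (fun x => u (ρ x)) ρ.source)
    (hα : ∀ i, LocallyIntegrableOn (fun x => α (ρ x) (coordVec ρ x i)) ρ.source)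
    (H : HasWeakGradFlat ρ.source (fun x => u (ρ x)) (fun x i => α (ρ x) (coordVec ρ x i))) :
    HasWeakGradM ρ.target u α := by
  intro X h hX hh hdiv
  have hs := contDiffOn_sqrt_det_gramMatrix hρ hJ
  obtain ⟨hXs, K, hKU, hK, hX0⟩ := hX
  set ζ : Fin d → Euc d → ℝ := fun i => ρ.source.indicator fun x =>
    Real.sqrt (gramMatrix ρ x).det * coordComp ρ (X (ρ x)) i with hζ
  have hζx : ∀ x ∈ ρ.source, ∀ i,
      ζ i x = Real.sqrt (gramMatrix ρ x).det * coordComp ρ (X (ρ x)) i :=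
    fun x hx i => indicator_of_mem hx _
  have hζT : ∀ i, IsTestFlat ρ.source (ζ i) := by
    intro i
    refine isTestFlat_of_contDiffOn ρ.open_source
      ((hs.mul (contDiffOn_coordComp hρ hXs.contMDiffOn i)).congr fun x hx => hζx x hx i)
      (isCompact_image_chart_symm ρ hK hKU) (image_chart_symm_subset ρ hKU) fun x hx => ?_
    by_cases hxV : x ∈ ρ.source
    · have h0 : X (ρ x) = 0 := hX0 _ fun hxK => hx ⟨_, hxK, ρ.left_inv hxV⟩
      rw [hζx x hxV, h0, ← coordBasis_repr hρ hxV]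
      simp
    · exact indicator_of_notMem hxV _
  have hdiv' := (hasWeakDivM_flatForm_iff hρ hJ X _ (ζ := fun x i => (ζ i x : ℂ))
    (fun x hx i => by rw [hζx x hx, Complex.ofReal_mul]) (fun x _ => rfl)).1 hdiv
  have hcont : ContinuousOn (fun x => (Real.sqrt (gramMatrix ρ x).det : ℂ) * (h (ρ x) : ℂ))
      ρ.source :=
    (Complex.continuous_ofReal.comp_continuousOn hs.continuousOn).mul
      (Complex.continuous_ofReal.comp_continuousOn
        (hh.1.continuous.comp_continuousOn ρ.continuousOn))
  have hcont' : Continuous fun x => ((∑ i, pderiv i (ζ i) x : ℝ) : ℂ) :=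
    Complex.continuous_ofReal.comp
      (continuous_finsetSum _ fun i _ => ((hζT i).pderiv i).1.continuous)
  have hae := hdiv'.ae_eq ρ.open_source (hasWeakDivFlat_of_isTestFlat hζT)
    (hcont.locallyIntegrableOn ρ.open_source.measurableSet)
    (hcont'.continuousOn.locallyIntegrableOn ρ.open_source.measurableSet)
  rw [integral_target hρ hJ.continuousOn, integral_target hρ hJ.continuousOn]
  calc ∫ x in ρ.source, (Real.sqrt (gramMatrix ρ x).det : ℂ) * (u (ρ x) * (h (ρ x) : ℂ))
      = ∫ x in ρ.source, ∑ i, u (ρ x) * (pderiv i (ζ i) x : ℂ) := by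
        refine integral_congr_ae ?_
        filter_upwards [hae] with x hx
        rw [← Finset.mul_sum, ← Complex.ofReal_sum, ← hx]
        ring
    _ = ∑ i, ∫ x in ρ.source, u (ρ x) * (pderiv i (ζ i) x : ℂ) :=
        integral_finsetSum _ fun i _ => integrableOn_mul_test hu ((hζT i).pderiv i)
    _ = ∑ i, -∫ x in ρ.source, α (ρ x) (coordVec ρ x i) * (ζ i x : ℂ) :=
        Finset.sum_congr rfl fun i _ => H (ζ i) (hζT i) i
    _ = -∫ x in ρ.source, ∑ i, α (ρ x) (coordVec ρ x i) * (ζ i x : ℂ) := by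
        rw [Finset.sum_neg_distrib,
          integral_finsetSum _ fun i _ => integrableOn_mul_test (hα i) (hζT i)]
    _ = _ := by
        congr 1
        refine setIntegral_congr_fun ρ.open_source.measurableSet fun x hx => ?_
        have e := sum_coordComp hρ hx (X (ρ x))
        have e' := congrArg (α (ρ x)) e
        rw [map_sum] at e'
        simp only [e', Finset.mul_sum, hζx x hx, map_smul, Complex.real_smul, Complex.ofReal_mul]
        exact Finset.sum_congr rfl fun i _ => by ring

end Operators

/-! ### Weighted spaces and conjugation of the operators -/

theorem normSqFlat_mono {d : ℕ} {K Ω : Set (Euc d)} (hK : K ⊆ Ω) (μ : Euc d → ℝ)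
    (W : Euc d → Matrix (Fin d) (Fin d) ℝ) (u : FlatPair d) :
    normSqFlat K μ W u ≤ normSqFlat Ω μ W u :=
  add_le_add (lintegral_mono_set hK) (lintegral_mono_set hK)

theorem MemL2Flat.memL2LocFlat {d : ℕ} {Ω : Set (Euc d)} {μ : Euc d → ℝ}
    {W : Euc d → Matrix (Fin d) (Fin d) ℝ} {u : FlatPair d} (h : MemL2Flat Ω μ W u) :
    MemL2LocFlat Ω μ W u :=
  ⟨h.1, fun _ hK _ => (normSqFlat_mono hK μ W u).trans_lt h.2⟩

section Weights

variable {d : ℕ} {M : Type*} [TopologicalSpace M] [ChartedSpace (Euc d) M]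
  [RiemannianBundle (fun y : M => TangentSpace (𝓡 d) y)]

/-- Weights `μ`, `W`, `ν` that are compatible with the metric `g` in the coordinates `ρ`:
`W = μ g⁻¹` and `√g ν = μ` hold everywhere on the parameter domain, with `μ > 0`. -/
structure CompatibleWeights (ρ : OpenPartialHomeomorph (Euc d) M) (μ : Euc d → ℝ)
    (W : Euc d → Matrix (Fin d) (Fin d) ℝ) (ν : M → ℝ) : Prop where
  atlas : ρ.symm ∈ IsManifold.maximalAtlas (𝓡 d) ∞ M
  contDiffOn_det : ContDiffOn ℝ ∞ (fun x => (gramMatrix ρ x).det) ρ.source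
  continuousOn_gram : ∀ i, ContinuousOn (fun x => gramMatrix ρ x i i) ρ.source
  continuousOn_weight : ContinuousOn μ ρ.source
  pos : ∀ x ∈ ρ.source, 0 < μ x
  matrix_eq : ∀ x ∈ ρ.source, W x = μ x • (gramMatrix ρ x)⁻¹
  density_eq : ∀ x ∈ ρ.source, Real.sqrt (gramMatrix ρ x).det * ν (ρ x) = μ x

variable {ρ : OpenPartialHomeomorph (Euc d) M} {μ : Euc d → ℝ}
  {W : Euc d → Matrix (Fin d) (Fin d) ℝ} {ν : M → ℝ}

theorem contDiffOn_det {Ω : Set (Euc d)} {A : Euc d → Matrix (Fin d) (Fin d) ℝ}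
    (hA : ∀ i j, ContDiffOn ℝ ∞ (fun x => A x i j) Ω) :
    ContDiffOn ℝ ∞ (fun x => (A x).det) Ω := by
  simp only [Matrix.det_apply']
  exact ContDiffOn.sum fun σ _ => contDiffOn_const.mul (contDiffOn_prod fun i _ => hA _ _)

/-- If the metric is `μ W⁻¹` with smooth weights that are positive almost everywhere, then `μ` is
positive everywhere: it is nonnegative by continuity, and cannot vanish because the metric is
nondegenerate. -/
theorem weight_pos (hρ : ρ.symm ∈ IsManifold.maximalAtlas (𝓡 d) ∞ M)
    (hμ : IsScalarWeight ρ.source μ) (hμc : ContinuousOn μ ρ.source)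
    (hg : ∀ x ∈ ρ.source, gramMatrix ρ x = metricMatrix μ W x) : ∀ x ∈ ρ.source, 0 < μ x := by
  have hae := (ae_restrict_iff' ρ.open_source.measurableSet).1 hμ
  -- an open subset of the domain on which `μ ≤ 0` is a null set, hence empty
  have hopen : ∀ S : Set (Euc d), IsOpen S → S ⊆ ρ.source → (∀ x ∈ S, ¬ 0 < μ x) → S = ∅ := by
    intro S hS hSV hSμ
    refine (hS.measure_eq_zero_iff (μ := volume)).1 (measure_mono_null (fun x hx => ?_) hae)
    exact fun h => hSμ x hx (h (hSV hx))
  intro x hx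
  by_contra hneg
  rcases Nat.eq_zero_or_pos d with rfl | hd
  -- in dimension zero the metric says nothing about `μ`, but a point is an open set
  · have := hopen {x} (isOpen_discrete _) (by simpa using hx) (by simpa using hneg)
    simp at this
  · have hne : μ x ≠ 0 := by
      intro h0
      have : NeZero d := ⟨hd.ne'⟩
      have hp := (gramMatrix_posDef hρ hx).det_pos
      rw [hg x hx, metricMatrix, h0, zero_smul, Matrix.det_zero] at hp
      exact hp.false
    have hlt : μ x < 0 := lt_of_le_of_ne (not_lt.1 hneg) hne
    have := hopen (ρ.source ∩ μ ⁻¹' Iio 0) (hμc.isOpen_inter_preimage ρ.open_source isOpen_Iio)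
      inter_subset_left fun z hz => not_lt.2 (le_of_lt hz.2)
    exact (this ▸ (⟨hx, hlt⟩ : x ∈ ρ.source ∩ μ ⁻¹' Iio 0) : x ∈ (∅ : Set (Euc d)))

/-- Smooth weights with `g = μ W⁻¹` and `ν = μ / √g` are compatible as soon as `μ > 0` almost
everywhere. -/
theorem compatibleWeights (hρ : ρ.symm ∈ IsManifold.maximalAtlas (𝓡 d) ∞ M)
    (hμ : IsScalarWeight ρ.source μ) (hμs : ContDiffOn ℝ ∞ μ ρ.source)
    (hWs : ∀ i j, ContDiffOn ℝ ∞ (fun x => W x i j) ρ.source)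
    (hg : ∀ x ∈ ρ.source, gramMatrix ρ x = metricMatrix μ W x)
    (hν : ∀ x ∈ ρ.source, ν (ρ x) = μ x / Real.sqrt (metricMatrix μ W x).det) :
    CompatibleWeights ρ μ W ν := by
  have hpos := weight_pos hρ hμ hμs.continuousOn hg
  have hunit : ∀ x ∈ ρ.source, IsUnit (W x).det := by
    intro x hx
    have hp := (gramMatrix_posDef hρ hx).det_pos.ne'
    rw [hg x hx, metricMatrix, Matrix.det_smul] at hp
    exact Matrix.isUnit_nonsing_inv_det_iff.1 (right_ne_zero_of_mul hp).isUnit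
  have hdetW := contDiffOn_det hWs
  refine ⟨hρ, ?_, fun i => ?_, hμs.continuousOn, hpos, fun x hx => ?_, fun x hx => ?_⟩
  · refine ((hμs.pow d).mul (hdetW.inv fun x hx => (hunit x hx).ne_zero)).congr fun x hx => ?_
    rw [hg x hx, metricMatrix, Matrix.det_smul, Matrix.det_nonsing_inv, Fintype.card_fin,
      Ring.inverse_eq_inv']
    rfl
  -- the diagonal of `μ W⁻¹` is continuous by the adjugate formula for the inverse
  · have hWc : ContinuousOn W ρ.source :=
      continuousOn_pi.2 fun i => continuousOn_pi.2 fun j => (hWs i j).continuousOn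
    have hadj : ContinuousOn (fun x => (W x).adjugate i i) ρ.source :=
      ((continuous_id.matrix_adjugate).matrix_elem i i).comp_continuousOn hWc
    refine (hμs.continuousOn.mul ((hdetW.continuousOn.inv₀ fun x hx =>
      (hunit x hx).ne_zero).mul hadj)).congr fun x hx => ?_
    rw [hg x hx, metricMatrix, Matrix.inv_def, Ring.inverse_eq_inv']
    simp
  · have hμ0 := (hpos x hx).ne'
    have hinv : (μ x • (W x)⁻¹)⁻¹ = (μ x)⁻¹ • W x := Matrix.inv_eq_right_inv (by
      rw [Matrix.smul_mul, Matrix.mul_smul, Matrix.nonsing_inv_mul _ (hunit x hx),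
        smul_inv_smul₀ hμ0])
    rw [hg x hx, metricMatrix, hinv, smul_inv_smul₀ hμ0]
  · have hs := (sqrt_det_gramMatrix_pos hρ hx).ne'
    rw [hν x hx, ← hg x hx, mul_div_cancel₀ _ hs]

/-- The norm of a covector at a point of the chart, in coordinates. -/
theorem covNormSq_eq (hρ : ρ.symm ∈ IsManifold.maximalAtlas (𝓡 d) ∞ M) {x : Euc d}
    (hx : x ∈ ρ.source) (α : TangentSpace (𝓡 d) (ρ x) →L[ℝ] ℂ) :
    (covNormSq α : ℂ) = ∑ i, applyW (gramMatrix ρ x)⁻¹ (fun j => α (coordVec ρ x j)) i *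
      conj (α (coordVec ρ x i)) := by
  have : FiniteDimensional ℝ (TangentSpace (𝓡 d) (ρ x)) :=
    inferInstanceAs (FiniteDimensional ℝ (Euc d))
  have h := sum_norm_sq_orthonormalBasis
    (stdOrthonormalBasis ℝ (TangentSpace (𝓡 d) (ρ x))) (coordBasis hρ hx) α
  simp only [gramOf_coordBasis, coordBasis_apply] at h
  exact h

theorem norm_sq_coordVec_le (hρ : ρ.symm ∈ IsManifold.maximalAtlas (𝓡 d) ∞ M) {x : Euc d}
    (hx : x ∈ ρ.source) (α : TangentSpace (𝓡 d) (ρ x) →L[ℝ] ℂ) (i : Fin d) :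
    ‖α (coordVec ρ x i)‖ ^ 2 ≤ gramMatrix ρ x i i * covNormSq α := by
  have : FiniteDimensional ℝ (TangentSpace (𝓡 d) (ρ x)) :=
    inferInstanceAs (FiniteDimensional ℝ (Euc d))
  have h := norm_sq_apply_le
    (stdOrthonormalBasis ℝ (TangentSpace (𝓡 d) (ρ x))) (coordBasis hρ hx) α i
  simp only [gramOf_coordBasis, coordBasis_apply] at h
  exact h

namespace CompatibleWeights

variable (h : CompatibleWeights ρ μ W ν)
include h

theorem applyW_eq {x : Euc d} (hx : x ∈ ρ.source) (ξ : Fin d → ℂ) (i : Fin d) :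
    applyW (W x) ξ i = (μ x : ℂ) * applyW (gramMatrix ρ x)⁻¹ ξ i := by
  simp only [applyW, h.matrix_eq x hx, Matrix.smul_apply, smul_eq_mul, Complex.ofReal_mul,
    Finset.mul_sum, mul_assoc]

/-- The two quadratic forms agree: `⟨W ξ, ξ⟩ = μ |α|²` for the pullback `ξ` of `α`. -/
theorem quadratic_eq (v : ManifoldPair d M) {x : Euc d} (hx : x ∈ ρ.source) :
    (∑ i, applyW (W x) ((Tiso ρ v).2 x) i * conj ((Tiso ρ v).2 x i)).re =
      μ x * covNormSq (v.2 (ρ x)) := by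
  have e : ∑ i, applyW (W x) ((Tiso ρ v).2 x) i * conj ((Tiso ρ v).2 x i) =
      ((μ x * covNormSq (v.2 (ρ x)) : ℝ) : ℂ) := by
    rw [Complex.ofReal_mul, covNormSq_eq h.atlas hx, Finset.mul_sum]
    exact Finset.sum_congr rfl fun i _ => by rw [h.applyW_eq hx, mul_assoc]; rfl
  rw [e, Complex.ofReal_re]

theorem locallyIntegrableOn_fst {v : ManifoldPair d M}
    (hv : MemL2LocFlat ρ.source μ W (Tiso ρ v)) :
    LocallyIntegrableOn (fun x => v.1 (ρ x)) ρ.source :=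
  locallyIntegrableOn_of_weighted ρ.open_source hv.1.1 h.continuousOn_weight h.pos
    fun K hKV hK => lt_of_le_of_lt le_self_add (hv.2 K hKV hK)

theorem locallyIntegrableOn_snd {v : ManifoldPair d M}
    (hv : MemL2LocFlat ρ.source μ W (Tiso ρ v)) (i : Fin d) :
    LocallyIntegrableOn (fun x => v.2 (ρ x) (coordVec ρ x i)) ρ.source := by
  have hgpos : ∀ x ∈ ρ.source, 0 < gramMatrix ρ x i i :=
    fun x hx => (gramMatrix_posDef h.atlas hx).diag_pos
  -- this weight is chosen because `|αᵢ|² ≤ gᵢᵢ |α|²`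
  refine locallyIntegrableOn_of_weighted (w := fun x => μ x / gramMatrix ρ x i i) ρ.open_source
    (aemeasurable_pi_iff.1 hv.1.2.aemeasurable i).aestronglyMeasurable
    (h.continuousOn_weight.div (h.continuousOn_gram i) fun x hx => (hgpos x hx).ne')
    (fun x hx => div_pos (h.pos x hx) (hgpos x hx)) fun K hKV hK => ?_
  refine lt_of_le_of_lt ?_ (lt_of_le_of_lt le_add_self (hv.2 K hKV hK))
  refine setLIntegral_mono' hK.measurableSet fun x hx => ENNReal.ofReal_le_ofReal ?_
  have hx' := hKV hx
  rw [h.quadratic_eq v hx', mul_div_assoc', div_le_iff₀ (hgpos x hx')]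
  have := mul_le_mul_of_nonneg_left (norm_sq_coordVec_le h.atlas hx' (v.2 (ρ x)) i)
    (h.pos x hx').le
  linarith

variable [MeasurableSpace M] [BorelSpace M]

theorem normSqM_eq {K : Set M} (hK : MeasurableSet K) (hKU : K ⊆ ρ.target)
    (v : ManifoldPair d M) :
    normSqM K ν v = normSqFlat (ρ.source ∩ ρ ⁻¹' K) μ W (Tiso ρ v) := by
  have hA := measurableSet_source_inter_preimage ρ hK
  have hJ := h.contDiffOn_det.continuousOn
  rw [normSqM, normSqFlat, setLIntegral_chart h.atlas hJ hK hKU,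
    setLIntegral_chart h.atlas hJ hK hKU]
  congr 1
  · refine setLIntegral_congr_fun hA fun x hx => ?_
    simp only [← ENNReal.ofReal_mul (Real.sqrt_nonneg _), ← h.density_eq x hx.1]
    congr 1
    simp only [Tiso, LinearMap.coe_mk, AddHom.coe_mk]
    ring
  · refine setLIntegral_congr_fun hA fun x hx => ?_
    simp only [← ENNReal.ofReal_mul (Real.sqrt_nonneg _)]
    rw [h.quadratic_eq v hx.1, ← h.density_eq x hx.1]
    congr 1
    ring

theorem normSqM_target (v : ManifoldPair d M) :
    normSqM ρ.target ν v = normSqFlat ρ.source μ W (Tiso ρ v) := by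
  rw [h.normSqM_eq ρ.open_target.measurableSet subset_rfl,
    inter_eq_left.2 (show ρ.source ⊆ ρ ⁻¹' ρ.target from fun _ hx => ρ.map_source hx)]

theorem aeEqM_iff (v v' : ManifoldPair d M) :
    AEEqM ρ.target v v' ↔ AEEqFlat ρ.source (Tiso ρ v) (Tiso ρ v') := by
  rw [AEEqM, ae_target_iff h.atlas h.contDiffOn_det.continuousOn, AEEqFlat]
  refine Filter.eventually_congr ?_
  filter_upwards [ae_restrict_mem ρ.open_source.measurableSet] with x hx
  refine and_congr Iff.rfl ⟨fun e => ?_, fun e => ?_⟩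
  · funext i
    exact congrArg (fun α => α (coordVec ρ x i)) e
  · refine ContinuousLinearMap.coe_injective ((coordBasis h.atlas hx).ext fun i => ?_)
    simp only [coordBasis_apply]
    exact congrFun e i

variable [IsManifold (𝓡 d) ∞ M]

theorem measurablePair_iff (v : ManifoldPair d M) :
    MeasurablePair ρ.target v ↔ MeasurableFlat ρ.source (Tiso ρ v) := by
  have hJ := h.contDiffOn_det.continuousOn
  refine and_congr (aestronglyMeasurable_target_iff h.atlas hJ) ⟨fun H => ?_, fun H X hX => ?_⟩
  · rw [aestronglyMeasurable_iff_aemeasurable]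
    refine aemeasurable_pi_iff.2 fun i => AEStronglyMeasurable.aemeasurable ?_
    have := (aestronglyMeasurable_target_iff h.atlas hJ).1
      (H _ (contMDiffOn_coordField h.atlas i))
    refine this.congr ?_
    filter_upwards [ae_restrict_mem ρ.open_source.measurableSet] with x hx
    rw [coordField_apply ρ hx]
    rfl
  · rw [aestronglyMeasurable_target_iff h.atlas hJ]
    have hi : ∀ i, AEStronglyMeasurable (fun x => (Tiso ρ v).2 x i) (volume.restrict ρ.source) :=
      fun i => (aemeasurable_pi_iff.1 H.aemeasurable i).aestronglyMeasurable
    have hc : ∀ i, AEStronglyMeasurable (fun x => coordComp ρ (X (ρ x)) i)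
        (volume.restrict ρ.source) := fun i =>
      (contDiffOn_coordComp h.atlas hX i).continuousOn.aestronglyMeasurable
        ρ.open_source.measurableSet
    refine (Finset.aestronglyMeasurable_fun_sum Finset.univ
      fun i _ => (hc i).smul (hi i)).congr ?_
    filter_upwards [ae_restrict_mem ρ.open_source.measurableSet] with x hx
    conv_rhs => rw [sum_coordComp h.atlas hx (X (ρ x)), map_sum]
    exact Finset.sum_congr rfl fun i _ => (map_smul (v.2 (ρ x)) _ _).symm

theorem memL2M_iff (v : ManifoldPair d M) :
    MemL2M ρ.target ν v ↔ MemL2Flat ρ.source μ W (Tiso ρ v) := by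
  rw [MemL2M, MemL2Flat, h.measurablePair_iff, h.normSqM_target]

theorem memL2LocM_iff [T2Space M] (v : ManifoldPair d M) :
    MemL2LocM ρ.target ν v ↔ MemL2LocFlat ρ.source μ W (Tiso ρ v) := by
  refine and_congr (h.measurablePair_iff v) ⟨fun H K hKV hK => ?_, fun H K hKU hK => ?_⟩
  · have hc := isCompact_image_chart ρ hK hKV
    have hsub := image_chart_subset ρ hKV
    have := H _ hsub hc
    rw [h.normSqM_eq hc.measurableSet hsub] at this
    exact (normSqFlat_mono (subset_inter hKV (subset_preimage_image ρ K)) μ W _).trans_lt this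
  · rw [h.normSqM_eq hK.measurableSet hKU]
    have hsub : ρ.source ∩ ρ ⁻¹' K ⊆ ρ.symm '' K := fun x hx => ⟨_, hx.2, ρ.left_inv hx.1⟩
    exact (normSqFlat_mono hsub μ W _).trans_lt
      (H _ (image_chart_symm_subset ρ hKU) (isCompact_image_chart_symm ρ hK hKU))

theorem isWeakDM_iff [T2Space M] {v f : ManifoldPair d M}
    (hv : MemL2LocFlat ρ.source μ W (Tiso ρ v)) (hf : MemL2LocFlat ρ.source μ W (Tiso ρ f)) :
    IsWeakDM ρ.target ν v f ↔ IsWeakD ρ.source μ W (Tiso ρ v) (Tiso ρ f) := by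
  refine and_congr ?_ ⟨fun H => H.flat h.atlas h.contDiffOn_det, fun H =>
    HasWeakGradFlat.manifold h.atlas h.contDiffOn_det (h.locallyIntegrableOn_fst hv)
      (h.locallyIntegrableOn_snd hf) H⟩
  rw [hasWeakDivM_iff h.atlas h.contDiffOn_det]
  have e1 : ∀ x ∈ ρ.source, (fun i => (Real.sqrt (gramMatrix ρ x).det : ℂ) *
      applyW (gramMatrix ρ x)⁻¹ (fun j => (ν (ρ x) • v.2 (ρ x)) (coordVec ρ x j)) i) =
        applyW (W x) ((Tiso ρ v).2 x) := by
    intro x hx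
    funext i
    rw [h.applyW_eq hx, ← h.density_eq x hx, Complex.ofReal_mul, mul_assoc]
    simp only [applyW, Finset.mul_sum]
    refine Finset.sum_congr rfl fun j _ => ?_
    simp only [smul_apply, Complex.real_smul, Tiso, LinearMap.coe_mk,
      AddHom.coe_mk]
    ring
  have e2 : ∀ x ∈ ρ.source, (Real.sqrt (gramMatrix ρ x).det : ℂ) *
      -((ν (ρ x) : ℂ) * f.1 (ρ x)) = -((μ x : ℂ) * (Tiso ρ f).1 x) := by
    intro x hx
    rw [← h.density_eq x hx, Complex.ofReal_mul]
    simp only [Tiso, LinearMap.coe_mk, AddHom.coe_mk]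
    ring
  exact ⟨HasWeakDivFlat.congr ρ.open_source e1 e2, HasWeakDivFlat.congr ρ.open_source
    (fun x hx => (e1 x hx).symm) (fun x hx => (e2 x hx).symm)⟩

/-- Every square integrable pair on the parameter domain is the pullback of a pair on `M`, whose
1-form is `∑ᵢ u₂ᵢ dxⁱ`. -/
theorem exists_memL2M {u : FlatPair d} (hu : MemL2Flat ρ.source μ W u) :
    ∃ v : ManifoldPair d M, MemL2M ρ.target ν v ∧ AEEqFlat ρ.source (Tiso ρ v) u := by
  let v : ManifoldPair d M := (fun y => u.1 (ρ.symm y),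
    fun y => ∑ i, (coordForm ρ y i).smulRight (u.2 (ρ.symm y) i))
  have hv : ∀ x ∈ ρ.source, u.1 x = (Tiso ρ v).1 x ∧ u.2 x = (Tiso ρ v).2 x := by
    intro x hx
    refine ⟨?_, funext fun i => ?_⟩
    · simp [Tiso, v, ρ.left_inv hx]
    · simp [Tiso, v, ρ.left_inv hx, coordForm_apply, coordComp_coordVec h.atlas hx,
        apply_ite Complex.ofReal]
  have hvae : ∀ᵐ x ∂(volume.restrict ρ.source),
      u.1 x = (Tiso ρ v).1 x ∧ u.2 x = (Tiso ρ v).2 x := by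
    filter_upwards [ae_restrict_mem ρ.open_source.measurableSet] with x hx
    exact hv x hx
  refine ⟨v, (h.memL2M_iff v).2 ⟨⟨hu.1.1.congr ?_, hu.1.2.congr ?_⟩, ?_⟩, ?_⟩
  · exact hvae.mono fun x hx => hx.1
  · exact hvae.mono fun x hx => hx.2
  · refine lt_of_eq_of_lt (congrArg₂ (· + ·) ?_ ?_) hu.2
    · refine setLIntegral_congr_fun ρ.open_source.measurableSet fun x hx => ?_
      simp only [(hv x hx).1]
    · refine setLIntegral_congr_fun ρ.open_source.measurableSet fun x hx => ?_
      simp only [(hv x hx).2]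
  · exact hvae.mono fun x hx => ⟨hx.1.symm, hx.2.symm⟩

end CompatibleWeights

end Weights

end RubberBand

end

theorem mainTheorem9 {d : ℕ}
    {M : Type*} [TopologicalSpace M] [T2Space M] [ChartedSpace (RubberBand.Euc d) M]
    [IsManifold (𝓡 d) ∞ M] [MeasurableSpace M] [BorelSpace M]
    [RiemannianBundle (fun y : M => TangentSpace (𝓡 d) y)]
    [IsContMDiffRiemannianBundle (𝓡 d) ∞ (RubberBand.Euc d)
      (fun y : M => TangentSpace (𝓡 d) y)]
    (ρ : OpenPartialHomeomorph (RubberBand.Euc d) M)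
    (hρ : ρ.symm ∈ IsManifold.maximalAtlas (𝓡 d) ∞ M)
    (μ : RubberBand.Euc d → ℝ) (W : RubberBand.Euc d → Matrix (Fin d) (Fin d) ℝ)
    (hμ : RubberBand.IsScalarWeight ρ.source μ) (hW : RubberBand.IsMatrixWeight ρ.source W)
    (hμs : ContDiffOn ℝ ∞ μ ρ.source)
    (hWs : ∀ i j, ContDiffOn ℝ ∞ (fun x => W x i j) ρ.source)
    (hg : ∀ x ∈ ρ.source, RubberBand.gramMatrix ρ x = RubberBand.metricMatrix μ W x)
    (ν : M → ℝ)
    (hν : ∀ x ∈ ρ.source, ν (ρ x) = μ x / Real.sqrt (RubberBand.metricMatrix μ W x).det) :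
    -- the pullback is well defined and injective on classes of almost everywhere equal pairs
    (∀ v v' : RubberBand.ManifoldPair d M,
      RubberBand.AEEqM ρ.target v v' ↔
        RubberBand.AEEqFlat ρ.source (RubberBand.Tiso ρ v) (RubberBand.Tiso ρ v')) ∧
    -- it maps the weighted `L²` space of `M` into the one of `ℝᵈ` and preserves the norm
    (∀ v : RubberBand.ManifoldPair d M,
      RubberBand.MemL2M ρ.target ν v ↔
        RubberBand.MemL2Flat ρ.source μ W (RubberBand.Tiso ρ v)) ∧
    (∀ v : RubberBand.ManifoldPair d M, RubberBand.MemL2M ρ.target ν v →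
      RubberBand.normSqFlat ρ.source μ W (RubberBand.Tiso ρ v) =
        RubberBand.normSqM ρ.target ν v) ∧
    -- it is onto
    (∀ u : RubberBand.FlatPair d, RubberBand.MemL2Flat ρ.source μ W u →
      ∃ v : RubberBand.ManifoldPair d M, RubberBand.MemL2M ρ.target ν v ∧
        RubberBand.AEEqFlat ρ.source (RubberBand.Tiso ρ v) u) ∧
    -- it conjugates `D` to `D_M`, as operators in the `L²` spaces, with equality of domains
    (∀ v f : RubberBand.ManifoldPair d M,
      RubberBand.GraphDM ρ.target ν v f ↔
        RubberBand.GraphD ρ.source μ W (RubberBand.Tiso ρ v) (RubberBand.Tiso ρ f)) ∧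
    -- and also on all of `L²_loc`, hence on smooth pairs
    (∀ v f : RubberBand.ManifoldPair d M,
      RubberBand.GraphDMLoc ρ.target ν v f ↔
        RubberBand.GraphDLoc ρ.source μ W (RubberBand.Tiso ρ v) (RubberBand.Tiso ρ f)) := by
  have h := RubberBand.compatibleWeights hρ hμ hμs hWs hg hν
  refine ⟨h.aeEqM_iff, h.memL2M_iff, fun v _ => (h.normSqM_target v).symm,
    fun _ hu => h.exists_memL2M hu, fun v f => ?_, fun v f => ?_⟩
  · rw [RubberBand.GraphDM, RubberBand.GraphD, h.memL2M_iff, h.memL2M_iff]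
    exact and_congr_right fun hv => and_congr_right fun hf =>
      h.isWeakDM_iff hv.memL2LocFlat hf.memL2LocFlat
  · rw [RubberBand.GraphDMLoc, RubberBand.GraphDLoc, h.memL2LocM_iff, h.memL2LocM_iff]
    exact and_congr_right fun hv => and_congr_right fun hf => h.isWeakDM_iff hv hf
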